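/- Let $\Omega\subset\mathbb R^2$ be a bounded polygonal Lipschitz domain with a conforming triangulation $\mathcal T_h$ into finitely many closed triangles, and let $\mathcal E_h$ be the set of all its (interior and boundary) edges. For every edge $e$ fix an adjacent triangle $K_+$, the unit normal $\boldsymbol n_e$ pointing out of $K_+$, and a unit tangent $\boldsymbol\tau_e$; for an interior edge let $K_-$ be the other adjacent triangle. The jump of a piecewise smooth $\varphi$ is $[\![\varphi]\!]_e=\varphi|_{K_+}-\varphi|_{K_-}$ on an interior edge and $[\![\varphi]\!]_e=\varphi|_{K_+}$ on a boundary edge. Write $\partial_n v=\nabla v\cdot\boldsymbol n_e$, $\partial_\tau v=\nabla v\cdot\boldsymbol\tau_e$, and for a matrix field $M$ put $M_{nn}=\boldsymbol n_e^TM\boldsymbol n_e$, $M_{n\tau}=\boldsymbol\tau_e^TM\boldsymbol n_e$; $\operatorname{div}M$ is the row-wise divergence, $D^2_{nn}v=(D^2v)_{nn}$ and $D^2_{n\tau}v=(D^2v)_{n\tau}$. Let $H^{-2}(\Omega)$ be the dual of $H^2_0(\Omega)$, and for $\sigma\in[L^2(\Omega)]^{2\times2}_{\rm sym}$ let $\operatorname{div}\operatorname{div}\sigma\in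 H^{-2}(\Omega)$ be given by $\langle\operatorname{div}\operatorname{div}\sigma,w\rangle=\int_\Omega\sigma:D^2w\,dx$. Let $f\in H^{-2}(\Omega)$, $\tilde f\in L^2(\Omega)$, $Q(v)=\int_\Omega\tilde f v\,dx$, and let $u,\tilde u\in H^2_0(\Omega)$ satisfy $$(D^2u,D^2v)=\langle f,v\rangle,\qquad (D^2\tilde u,D^2v)=(\tilde f,v)\qquad\text{for all } v\in H^2_0(\Omega).$$ Let $u_h,\tilde u_h\in L^2(\Omega)$ be arbitrary piecewise polynomials of degree at most $k$ on $\mathcal T_h$, let $s_h,\tilde s_h\in H^2_0(\Omega)\cap C^1(\bar\Omega)$, and let $\sigma_h^{\rm eq},\tilde\sigma_h^{\rm eq}\in[L^2(\Omega)]^{2\times2}_{\rm sym}$ be equilibrated moment tensors, i.e. $\operatorname{div}\operatorname{div}\sigma_h^{\rm eq}=f_h$ and $\operatorname{div}\operatorname{div}\tilde\sigma_h^{\rm eq}=\tilde f_h$ for some $f_h,\tilde f_h\in H^{-2}(\Omega)$. Assume that $\tilde u$ and $\tilde\sigma_h^{\rm eq}$ are regular enough for the edge integrals below to make sense: $M=D^2\tilde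 u$ on $\Omega$, and $M=\tilde\sigma_h^{\rm eq}$ on each triangle, have $\operatorname{div}M$ and $\operatorname{div}\operatorname{div}M$ in $L^1$, and on the edges $e$ of $\mathcal T_h$ (of the triangle) $M\boldsymbol n_e$ has traces in $L^1(e)$ and $\operatorname{div}M\cdot\boldsymbol n_e$ has traces in the $L^1$ space on $e$ with weight $|[\![u_h]\!]_e|$. Here traces are limits of restrictions: each row $q$ of $M$ (and $q=\operatorname{div}M$) is a limit of fields $\Phi_m\in C^\infty(\mathbb R^2)^2$ with $\Phi_m\to q$ and $\operatorname{div}\Phi_m\to\operatorname{div}q$ in $L^1$ on $\Omega$ (on the triangle), such that $\Phi_m\cdot\boldsymbol n_e$ converges on every edge $e$ in the respective $L^1$ space to the trace. (This holds, for instance, if $\tilde u\in W^{4,1}(\Omega)$ and $\tilde\sigma_h^{\rm eq}$ is piecewise polynomial.) If the traces of $\tilde\sigma_h^{\rm eq}$ from the two sides of an interior edge differ, its value on $e$ is any fixed combination $(1-w_e)\,\cdot|_{K_+}+w_e\,\cdot|_{K_-}$, $w_e\in\mathbb R$, the same one throughout. Then $$Q(u)-Q(u_h)=\eta_h+\mathcal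 R_h,$$ where $$\begin{aligned}\eta_h={}&\langle f,\tilde s_h\rangle-\sum_{K\in\mathcal T_h}\int_K\sigma_h^{\rm eq}:D^2\tilde s_h\,dx+\sum_{K\in\mathcal T_h}\int_K(\sigma_h^{\rm eq}-D^2u_h):\tilde\sigma_h^{\rm eq}\,dx\\&+\sum_{e\in\mathcal E_h}\int_e[\![\partial_\tau u_h]\!]_e\,\tilde\sigma^{\rm eq}_{h,n\tau}\,ds+\sum_{e\in\mathcal E_h}\int_e[\![\partial_nu_h]\!]_e\,\tilde\sigma^{\rm eq}_{h,nn}\,ds-\sum_{e\in\mathcal E_h}\int_e[\![u_h]\!]_e\operatorname{div}\tilde\sigma_h^{\rm eq}\cdot\boldsymbol n_e\,ds\end{aligned}$$ and $$\begin{aligned}\mathcal R_h={}&\langle f-\operatorname{div}\operatorname{div}\sigma_h^{\rm eq},\tilde u-\tilde s_h\rangle+\sum_{K\in\mathcal T_h}\int_K(\sigma_h^{\rm eq}-D^2u_h):(D^2\tilde u-\tilde\sigma_h^{\rm eq})\,dx\\&+\sum_{e\in\mathcal E_h}\int_e[\![\partial_\tau u_h]\!]_e(D^2_{n\tau}\tilde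 u-\tilde\sigma^{\rm eq}_{h,n\tau})\,ds+\sum_{e\in\mathcal E_h}\int_e[\![\partial_nu_h]\!]_e(D^2_{nn}\tilde u-\tilde\sigma^{\rm eq}_{h,nn})\,ds\\&-\sum_{e\in\mathcal E_h}\int_e[\![u_h]\!]_e\big(\operatorname{div}(D^2\tilde u)-\operatorname{div}\tilde\sigma_h^{\rm eq}\big)\cdot\boldsymbol n_e\,ds.\end{aligned}$$ -/

import Mathlib

open MeasureTheory Filter Topology
open scoped ContDiff

noncomputable section

namespace GoalBiharmonic

/-- The Euclidean plane. -/
abbrev Plane : Type := EuclideanSpace ℝ (Fin 2)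

/-- The partial derivative `∂φ/∂xᵢ`. -/
def pd (i : Fin 2) (φ : Plane → ℝ) (x : Plane) : ℝ :=
  fderiv ℝ φ x (EuclideanSpace.single i 1)

/-! ### The spaces `L²(Ω)`, `H²₀(Ω)`, `H⁻²(Ω)` -/

/-- `L²(Ω)`. -/
abbrev L2 (Ω : Set Plane) : Type := Lp ℝ 2 (volume.restrict Ω)

/-- `2 × 2` matrix valued functions with entries in `L²(Ω)`. -/
abbrev Tensor (Ω : Set Plane) : Type := Fin 2 → Fin 2 → L2 Ω

/-- Triples `(v, ∇v, D²v)` with entries in `L²(Ω)`; the (maximum of the) `L²` norms of the entries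
is a norm equivalent to the `H²(Ω)` norm. -/
abbrev Jet (Ω : Set Plane) : Type := L2 Ω × (Fin 2 → L2 Ω) × Tensor Ω

/-- `x` is the triple `(φ, ∇φ, D²φ)` of a function `φ ∈ C_c^∞(Ω)`. -/
def IsTestJet (Ω : Set Plane) (x : Jet Ω) : Prop :=
  ∃ φ : Plane → ℝ, ContDiff ℝ ∞ φ ∧ HasCompactSupport φ ∧ tsupport φ ⊆ Ω ∧
    x.1 =ᵐ[volume.restrict Ω] φ ∧
    (∀ i, x.2.1 i =ᵐ[volume.restrict Ω] pd i φ) ∧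
    ∀ i j, x.2.2 i j =ᵐ[volume.restrict Ω] pd i (pd j φ)

/-- `H²₀(Ω)`: the closure of `C_c^∞(Ω)` in the `H²(Ω)` norm, each function being stored together
with its first and second weak derivatives. (The triples of test functions already form a linear
space, so that the span adds nothing.) -/
def H20 (Ω : Set Plane) : Submodule ℝ (Jet Ω) :=
  (Submodule.span ℝ {x : Jet Ω | IsTestJet Ω x}).topologicalClosure

/-- `H⁻²(Ω)`, the dual space of `H²₀(Ω)`. -/
abbrev HMinus2 (Ω : Set Plane) : Type := H20 Ω →L[ℝ] ℝ

/-- The `L²(Ω)` function underlying `v ∈ H²₀(Ω)`. -/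
def fnOf {Ω : Set Plane} (v : H20 Ω) : L2 Ω := (v : Jet Ω).1

/-- The matrix `D²v` of second order weak derivatives of `v ∈ H²₀(Ω)`. -/
def D2 {Ω : Set Plane} (v : H20 Ω) : Tensor Ω := (v : Jet Ω).2.2

/-- `∫_A p : q dx`. -/
def tensorIntegral (A : Set Plane) (p q : Fin 2 → Fin 2 → Plane → ℝ) : ℝ :=
  ∫ x in A, ∑ i, ∑ j, p i j x * q i j x

/-- The functions that represent the entries of an `L²` tensor. -/
def Tensor.fn {Ω : Set Plane} (σ : Tensor Ω) : Fin 2 → Fin 2 → Plane → ℝ := fun i j x => σ i j x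

/-- `v ↦ D²v` in the entry `(i, j)`, as a continuous linear map. -/
def hessCLM (Ω : Set Plane) (i j : Fin 2) : H20 Ω →L[ℝ] L2 Ω :=
  (ContinuousLinearMap.proj (R := ℝ) (φ := fun _ : Fin 2 => L2 Ω) j).comp
    ((ContinuousLinearMap.proj (R := ℝ) (φ := fun _ : Fin 2 => Fin 2 → L2 Ω) i).comp
      ((ContinuousLinearMap.snd ℝ (Fin 2 → L2 Ω) (Tensor Ω)).comp
        ((ContinuousLinearMap.snd ℝ (L2 Ω) ((Fin 2 → L2 Ω) × Tensor Ω)).comp (H20 Ω).subtypeL)))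

/-- The distribution `div div σ ∈ H⁻²(Ω)`, given by `⟨div div σ, w⟩ = ∫_Ω σ : D²w dx`
(see `divDiv_apply`). -/
def divDiv {Ω : Set Plane} (σ : Tensor Ω) : HMinus2 Ω :=
  ∑ i, ∑ j, (innerSL ℝ (σ i j)).comp (hessCLM Ω i j)

theorem divDiv_apply {Ω : Set Plane} (σ : Tensor Ω) (w : H20 Ω) :
    divDiv σ w = tensorIntegral Ω σ.fn (D2 w).fn := by
  have hint : ∀ i j, Integrable (fun x => σ i j x * D2 w i j x) (volume.restrict Ω) := by
    intro i j
    have h := L2.integrable_inner (𝕜 := ℝ) (σ i j) (D2 w i j)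
    refine h.congr (Eventually.of_forall fun x => ?_)
    simp [mul_comm]
  have h : divDiv σ w = ∑ i, ∑ j, inner ℝ (σ i j) (D2 w i j) := by
    simp [divDiv, hessCLM, D2]
  rw [h]
  simp only [tensorIntegral, Tensor.fn]
  rw [integral_finsetSum _ fun i _ => integrable_finsetSum _ fun j _ => hint i j]
  refine Finset.sum_congr rfl fun i _ => ?_
  rw [integral_finsetSum _ fun j _ => hint i j]
  refine Finset.sum_congr rfl fun j _ => ?_
  rw [L2.inner_def]
  refine integral_congr_ae (Eventually.of_forall fun x => ?_)
  simp [mul_comm]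

/-! ### The primal problem, the goal functional, the dual problem -/

/-- `u ∈ H²₀(Ω)` is the weak solution of `Δ²u = f`, `u = ∂u/∂ν = 0` on `∂Ω`, where `f ∈ H⁻²(Ω)`. -/
def IsPrimalSolution {Ω : Set Plane} (f : HMinus2 Ω) (u : H20 Ω) : Prop :=
  ∀ v : H20 Ω, tensorIntegral Ω (D2 u).fn (D2 v).fn = f v

/-- The goal functional `Q(v) = (f̃, v)` with weight `f̃ ∈ L²(Ω)`. -/
def goal {Ω : Set Plane} (ft v : L2 Ω) : ℝ := ∫ x in Ω, ft x * v x

/-- `ũ ∈ H²₀(Ω)` is the weak solution of the dual problem with load `f̃ ∈ L²(Ω)`. -/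
def IsDualSolution {Ω : Set Plane} (ft : L2 Ω) (ut : H20 Ω) : Prop :=
  ∀ v : H20 Ω, tensorIntegral Ω (D2 ut).fn (D2 v).fn = goal ft (fnOf v)

/-- `s ∈ H²₀(Ω) ∩ C¹(Ω̄)`. -/
def IsPotentialReconstruction {Ω : Set Plane} (s : H20 Ω) : Prop :=
  ∃ (g : Plane → ℝ) (g' : Plane → Plane →L[ℝ] ℝ),
    ContinuousOn g (closure Ω) ∧ ContinuousOn g' (closure Ω) ∧
    (∀ x ∈ Ω, HasFDerivAt g (g' x) x) ∧ fnOf s =ᵐ[volume.restrict Ω] g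

/-- `σ ∈ [L²(Ω)]^{2×2}_sym` is an equilibrated moment tensor for `f_h ∈ H⁻²(Ω)`. -/
def IsEquilibrated {Ω : Set Plane} (fh : HMinus2 Ω) (σ : Tensor Ω) : Prop :=
  (∀ i j, σ i j = σ j i) ∧ ∀ w : H20 Ω, divDiv σ w = fh w

/-! ### Triangulations -/

/-- A conforming triangulation of the bounded polygonal domain `Ω` into closed triangles: a finite
geometric simplicial complex all of whose simplices lie in triangles and which fills `Ω̄`. -/
structure Triangulation (Ω : Set Plane) where
  complex : Geometry.SimplicialComplex ℝ Plane
  finite_faces : complex.faces.Finite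
  exists_triangle : ∀ s ∈ complex.faces, ∃ T ∈ complex.faces, s ⊆ T ∧ T.card = 3
  domain_eq : Ω = interior complex.space

namespace Triangulation

variable {Ω : Set Plane} (𝒯 : Triangulation Ω)

/-- The triangles, each given by its set of vertices. -/
def triangles : Finset (Finset Plane) := {T ∈ 𝒯.finite_faces.toFinset | T.card = 3}

/-- The edges, interior and boundary ones, each given by its set of endpoints. -/
def edges : Finset (Finset Plane) := {e ∈ 𝒯.finite_faces.toFinset | e.card = 2}

open Classical in
/-- The edges of the triangle `T`. -/
def edgesOf (T : Finset Plane) : Finset (Finset Plane) := {e ∈ 𝒯.edges | e ⊆ T}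

end Triangulation

/-- The closed triangle or segment with the given vertices. -/
def hull (s : Finset Plane) : Set Plane := convexHull ℝ (s : Set Plane)

/-- `∫_e g ds`, with respect to arc length. -/
def edgeIntegral (e : Finset Plane) (g : Plane → ℝ) : ℝ :=
  ∫ x in hull e, g x ∂(Measure.hausdorffMeasure 1)

/-- A choice, for every edge `e`, of the adjacent triangle `K₊`, of the unit normal `n_e` that points
out of `K₊` (so out of `Ω` if `e` lies on the boundary), and of a unit tangent `τ_e`. -/
structure EdgeFrame {Ω : Set Plane} (𝒯 : Triangulation Ω) where
  plus : Finset Plane → Finset Plane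
  n : Finset Plane → Plane
  τ : Finset Plane → Plane
  plus_mem : ∀ e ∈ 𝒯.edges, plus e ∈ 𝒯.triangles
  subset_plus : ∀ e ∈ 𝒯.edges, e ⊆ plus e
  norm_n : ∀ e ∈ 𝒯.edges, ‖n e‖ = 1
  norm_τ : ∀ e ∈ 𝒯.edges, ‖τ e‖ = 1
  n_perp : ∀ e ∈ 𝒯.edges, ∀ x ∈ e, ∀ y ∈ e, inner ℝ (n e) (y - x) = 0
  τ_perp : ∀ e ∈ 𝒯.edges, inner ℝ (n e) (τ e) = 0
  n_outward : ∀ e ∈ 𝒯.edges, ∀ x ∈ e, ∀ y ∈ plus e, inner ℝ (n e) (y - x) ≤ 0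

namespace EdgeFrame

variable {Ω : Set Plane} {𝒯 : Triangulation Ω} (F : EdgeFrame 𝒯)

open Classical in
/-- The triangles adjacent to `e` other than `K₊`: just `K₋` if `e` is an interior edge, none if `e`
is a boundary edge. -/
def minus (e : Finset Plane) : Finset (Finset Plane) :=
  {T ∈ 𝒯.triangles | e ⊆ T ∧ T ≠ F.plus e}

/-- The jump `φ|_{K₊} - φ|_{K₋}` across an interior edge, and `φ|_{K₊}` on a boundary edge, of a
function that is given by `φ T` on the triangle `T`. -/
def jump (φ : Finset Plane → Plane → ℝ) (e : Finset Plane) (x : Plane) : ℝ :=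
  φ (F.plus e) x - ∑ T ∈ F.minus e, φ T x

/-- The value `(1 - w) φ|_{K₊} + w φ|_{K₋}` on an interior edge, and `φ|_{K₊}` on a boundary edge.
It does not depend on `w` if `φ|_{K₊} = φ|_{K₋}` on `e`; `w = 1/2` gives the average. -/
def edgeValue (w : ℝ) (φ : Finset Plane → Plane → ℝ) (e : Finset Plane) (x : Plane) : ℝ :=
  φ (F.plus e) x - w * ∑ T ∈ F.minus e, (φ (F.plus e) x - φ T x)

end EdgeFrame

/-! ### Piecewise polynomials -/

/-- `ℙ_k(𝒯)`: the functions in `L²(Ω)` that are a polynomial of degree at most `k` on every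
triangle. -/
structure BrokenPoly {Ω : Set Plane} (𝒯 : Triangulation Ω) (k : ℕ) where
  toL2 : L2 Ω
  piece : Finset Plane → MvPolynomial (Fin 2) ℝ
  degree_le : ∀ T ∈ 𝒯.triangles, (piece T).totalDegree ≤ k
  ae_eq : ∀ T ∈ 𝒯.triangles,
    toL2 =ᵐ[volume.restrict (hull T)] fun x => MvPolynomial.eval (fun i => x i) (piece T)

namespace BrokenPoly

variable {Ω : Set Plane} {𝒯 : Triangulation Ω} {k : ℕ} (v : BrokenPoly 𝒯 k)

/-- The polynomial `v|_T`. -/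
def val (T : Finset Plane) (x : Plane) : ℝ := MvPolynomial.eval (fun i => x i) (v.piece T)

/-- The gradient of `v|_T`. -/
def grad (i : Fin 2) (T : Finset Plane) (x : Plane) : ℝ :=
  MvPolynomial.eval (fun i => x i) (MvPolynomial.pderiv i (v.piece T))

/-- The matrix `D²(v|_T)`. -/
def hess (T : Finset Plane) (i j : Fin 2) (x : Plane) : ℝ :=
  MvPolynomial.eval (fun i => x i) (MvPolynomial.pderiv i (MvPolynomial.pderiv j (v.piece T)))

/-- The jump of `v`. -/
def jump (F : EdgeFrame 𝒯) (e : Finset Plane) (x : Plane) : ℝ := F.jump v.val e x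

/-- The jump of the normal derivative `∂_n v = ∇v · n_e`. -/
def jumpN (F : EdgeFrame 𝒯) (e : Finset Plane) (x : Plane) : ℝ :=
  F.jump (fun T y => ∑ i, v.grad i T y * F.n e i) e x

/-- The jump of the tangential derivative `∂_τ v = ∇v · τ_e`. -/
def jumpT (F : EdgeFrame 𝒯) (e : Finset Plane) (x : Plane) : ℝ :=
  F.jump (fun T y => ∑ i, v.grad i T y * F.τ e i) e x

end BrokenPoly

/-! ### Traces on edges -/

/-- The vector field `q` on `U` has the weak divergence `r` and the normal traces `q · n_e = ψ_e` on
the edges `e ∈ s`. As usual, traces are the continuous extension of the restriction of smooth fields: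
fields `Φ_m ∈ C^∞(ℝ²)²` exist such that `Φ_m → q` and `div Φ_m → r` in `L¹(U)` while
`Φ_m · n_e → ψ_e` on `e` in the `L¹` space with weight `|j_e|`. The weight `1` gives the usual trace
in `L¹(e)`; only `j_e ψ_e` matters otherwise. -/
def HasNormalTrace (U : Set Plane) (s : Finset (Finset Plane)) (n : Finset Plane → Plane)
    (j : Finset Plane → Plane → ℝ) (q : Fin 2 → Plane → ℝ) (r : Plane → ℝ)
    (ψ : Finset Plane → Plane → ℝ) : Prop :=
  (∀ i, IntegrableOn (q i) U) ∧ IntegrableOn r U ∧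
  (∀ e ∈ s, IntegrableOn (fun x => j e x * ψ e x) (hull e) (Measure.hausdorffMeasure 1)) ∧
  ∃ Φ : ℕ → Fin 2 → Plane → ℝ,
    (∀ m i, ContDiff ℝ ∞ (Φ m i)) ∧
    (∀ i, Tendsto (fun m => ∫ x in U, |Φ m i x - q i x|) atTop (𝓝 0)) ∧
    Tendsto (fun m => ∫ x in U, |(∑ i, pd i (Φ m i) x) - r x|) atTop (𝓝 0) ∧
    ∀ e ∈ s, Tendsto
      (fun m => edgeIntegral e fun x => |j e x| * |(∑ i, Φ m i x * n e i) - ψ e x|) atTop (𝓝 0)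

/-- The tensor `M` on `U` has the weak divergence `div M` (taken row by row) and the weak second
divergence `div div M` in `L¹(U)`, and on the edges `e ∈ s` the vector `M n_e` has the trace `t_e` in
`L¹(e)` and the scalar `div M · n_e` has the trace `d_e` in the `L¹` space with weight `|j_e|`. -/
def HasMomentTrace (U : Set Plane) (s : Finset (Finset Plane)) (n : Finset Plane → Plane)
    (j : Finset Plane → Plane → ℝ) (M : Fin 2 → Fin 2 → Plane → ℝ)
    (t : Finset Plane → Fin 2 → Plane → ℝ) (d : Finset Plane → Plane → ℝ) : Prop :=
  ∃ (q : Fin 2 → Plane → ℝ) (r : Plane → ℝ),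
    (∀ i, HasNormalTrace U s n (fun _ _ => 1) (M i) (q i) (fun e => t e i)) ∧
    HasNormalTrace U s n j q r d

/-- The traces of a tensor on every edge: `vec e` is `M n_e`, and `div e` is `div M · n_e`. -/
structure EdgeTraces where
  vec : Finset Plane → Fin 2 → Plane → ℝ
  div : Finset Plane → Plane → ℝ

namespace EdgeTraces

variable {Ω : Set Plane} {𝒯 : Triangulation Ω}

/-- `M_nn = n_eᵀ M n_e`. -/
def nn (t : EdgeTraces) (F : EdgeFrame 𝒯) (e : Finset Plane) (x : Plane) : ℝ :=
  ∑ i, F.n e i * t.vec e i x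

/-- `M_nτ = τ_eᵀ M n_e`. -/
def nτ (t : EdgeTraces) (F : EdgeFrame 𝒯) (e : Finset Plane) (x : Plane) : ℝ :=
  ∑ i, F.τ e i * t.vec e i x

/-- The edge values of a tensor whose traces from the triangle `T` are `t T`. -/
def glue (F : EdgeFrame 𝒯) (w : Finset Plane → ℝ) (t : Finset Plane → EdgeTraces) :
    EdgeTraces where
  vec e i := F.edgeValue (w e) (fun T => (t T).vec e i) e
  div e := F.edgeValue (w e) (fun T => (t T).div e) e

end EdgeTraces

/-! ### Estimator and remainder -/

variable {Ω : Set Plane} {𝒯 : Triangulation Ω} {k : ℕ}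

/-- The estimator `η_h`; `S` are the edge values of `σ̃_h^eq`. -/
def estimator (F : EdgeFrame 𝒯) (f : HMinus2 Ω) (uh : BrokenPoly 𝒯 k) (st : H20 Ω)
    (σ σt : Tensor Ω) (S : EdgeTraces) : ℝ :=
  f st - ∑ T ∈ 𝒯.triangles, tensorIntegral (hull T) σ.fn (D2 st).fn
    + ∑ T ∈ 𝒯.triangles, tensorIntegral (hull T) (σ.fn - uh.hess T) σt.fn
    + ∑ e ∈ 𝒯.edges, edgeIntegral e (fun x => uh.jumpT F e x * S.nτ F e x)
    + ∑ e ∈ 𝒯.edges, edgeIntegral e (fun x => uh.jumpN F e x * S.nn F e x)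
    - ∑ e ∈ 𝒯.edges, edgeIntegral e (fun x => uh.jump F e x * S.div e x)

/-- The remainder `R_h`; `S` and `D` are the edge values of `σ̃_h^eq` and of `D²ũ`. -/
def remainder (F : EdgeFrame 𝒯) (f : HMinus2 Ω) (ut : H20 Ω) (uh : BrokenPoly 𝒯 k) (st : H20 Ω)
    (σ σt : Tensor Ω) (S D : EdgeTraces) : ℝ :=
  (f - divDiv σ) (ut - st)
    + ∑ T ∈ 𝒯.triangles, tensorIntegral (hull T) (σ.fn - uh.hess T) ((D2 ut).fn - σt.fn)
    + ∑ e ∈ 𝒯.edges, edgeIntegral e (fun x => uh.jumpT F e x * (D.nτ F e x - S.nτ F e x))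
    + ∑ e ∈ 𝒯.edges, edgeIntegral e (fun x => uh.jumpN F e x * (D.nn F e x - S.nn F e x))
    - ∑ e ∈ 𝒯.edges, edgeIntegral e (fun x => uh.jump F e x * (D.div e x - S.div e x))

end GoalBiharmonic

end

open GoalBiharmonic

noncomputable section

namespace GoalBiharmonic

/-! Testing the dual problem with `u` and the primal one with `ũ` gives Q(u) = ⟨f, ũ⟩. In η_h + R_h
all terms with s̃_h, σ_h^eq or σ̃_h^eq cancel; what remains is ⟨f, ũ⟩ - Σ_K ∫ D²u_h : D²ũ together
with the jumps of u_h paired with the traces of D²ũ. Everything therefore rests on the formula for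
Q(u_h) in `goal_brokenPoly`.

That formula comes from the strong form div div D²ũ = f̃ (`IsDualSolution.ae_eq`) and two
integrations by parts on the mesh: u_h against div(div D²ũ), then each ∂ᵢu_h against the i-th row of
D²ũ. The jump of ∇u_h is resolved in the orthonormal frame (τ_e, n_e) by `EdgeFrame.sum_mul_eq`.

Since D²ũ has traces only as limits of smooth fields, Green's formula is first proved for smooth Φ
(`EdgeFrame.sum_setIntegral_div`). Such a Φ is single valued on every edge, so only the jump of the
piecewise smooth factor survives. `HasNormalTrace.sum_setIntegral` then passes to the limit: the
volume terms converge by L¹ convergence of Φ and div Φ, the edge terms because the jump of the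
factor is dominated by the weight of the trace space.

Underneath lie the divergence theorem on a triangle (`setIntegral_hull_pd`), obtained from the
fundamental theorem of calculus on a reference triangle and the rule "twice the area is base times
height", and two facts about conforming meshes: the triangles fill Ω without overlap up to null sets
(`Triangulation.setIntegral_domain`), and n_e points into the second triangle at e
(`EdgeFrame.n_inward`). -/

/-! ### Integration on the reference triangle. -/

/-- The reference triangle in `ℝ × ℝ`. -/
def refTriangle : Set (ℝ × ℝ) := {p | 0 ≤ p.1 ∧ 0 ≤ p.2 ∧ p.1 + p.2 ≤ 1}

theorem isCompact_refTriangle : IsCompact refTriangle := by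
  refine (isCompact_Icc (a := (0 : ℝ × ℝ)) (b := 1)).of_isClosed_subset ?_ ?_
  · have h1 : IsClosed {p : ℝ × ℝ | 0 ≤ p.1} := isClosed_le continuous_const continuous_fst
    have h2 : IsClosed {p : ℝ × ℝ | 0 ≤ p.2} := isClosed_le continuous_const continuous_snd
    have h3 : IsClosed {p : ℝ × ℝ | p.1 + p.2 ≤ 1} :=
      isClosed_le (by fun_prop) continuous_const
    exact h1.inter (h2.inter h3)
  · rintro ⟨s, t⟩ ⟨h1, h2, h3⟩
    simp only at h1 h2 h3
    refine ⟨⟨h1, h2⟩, ⟨?_, ?_⟩⟩ <;> simp <;> linarith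

/-- Fubini's theorem on the reference triangle. -/
theorem setIntegral_refTriangle {h : ℝ × ℝ → ℝ} (hh : Continuous h) :
    ∫ p in refTriangle, h p = ∫ t in (0 : ℝ)..1, ∫ s in (0 : ℝ)..(1 - t), h (s, t) := by
  have hint : Integrable (refTriangle.indicator h) (volume.prod volume) := by
    rw [← Measure.volume_eq_prod]
    exact (hh.continuousOn.integrableOn_compact isCompact_refTriangle).integrable_indicator
      isCompact_refTriangle.measurableSet
  rw [← integral_indicator isCompact_refTriangle.measurableSet, Measure.volume_eq_prod,
    integral_prod_symm _ hint, intervalIntegral.integral_of_le zero_le_one,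
    ← integral_Icc_eq_integral_Ioc, ← integral_indicator measurableSet_Icc]
  refine integral_congr_ae (Eventually.of_forall fun t => ?_)
  simp only [Set.indicator]
  split_ifs with ht
  · rw [intervalIntegral.integral_of_le (by linarith [ht.2]), ← integral_Icc_eq_integral_Ioc,
      ← integral_indicator measurableSet_Icc]
    refine integral_congr_ae (Eventually.of_forall fun s => ?_)
    have : (s, t) ∈ refTriangle ↔ s ∈ Set.Icc 0 (1 - t) := by
      simp only [refTriangle, Set.mem_ofPred_eq, Set.mem_Icc]
      constructor
      · rintro ⟨h1, h2, h3⟩; exact ⟨h1, by linarith⟩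
      · rintro ⟨h1, h2⟩; exact ⟨h1, ht.1, by linarith⟩
    simp only [Set.indicator, this]
  · refine integral_eq_zero_of_ae (Eventually.of_forall fun s => ?_)
    refine if_neg ?_
    rintro ⟨h1, h2, h3⟩
    simp only at h1 h2 h3
    exact ht ⟨h2, by linarith⟩

theorem setIntegral_refTriangle_swap (h : ℝ × ℝ → ℝ) :
    ∫ p in refTriangle, h p.swap = ∫ p in refTriangle, h p := by
  have hp : MeasurePreserving (Prod.swap : ℝ × ℝ → ℝ × ℝ) volume volume := by
    rw [Measure.volume_eq_prod]; exact Measure.measurePreserving_swap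
  have := hp.setIntegral_preimage_emb MeasurableEquiv.prodComm.measurableEmbedding h refTriangle
  rw [← this]
  congr 2
  ext ⟨s, t⟩
  simp only [refTriangle, Set.mem_ofPred_eq, Set.mem_preimage, Prod.swap_prod_mk]
  constructor <;> rintro ⟨h1, h2, h3⟩ <;> exact ⟨h2, h1, by linarith⟩

/-- Fubini and the fundamental theorem of calculus on each horizontal chord, which runs from the
vertical leg to the hypotenuse. -/
theorem setIntegral_refTriangle_fderiv_fst {G : ℝ × ℝ → ℝ} (hG : ContDiff ℝ 1 G) :
    ∫ p in refTriangle, fderiv ℝ G p (1, 0) = ∫ t in (0 : ℝ)..1, (G (1 - t, t) - G (0, t)) := by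
  have hc : Continuous fun p => fderiv ℝ G p (1, 0) :=
    (hG.continuous_fderiv one_ne_zero).clm_apply continuous_const
  rw [setIntegral_refTriangle hc]
  refine intervalIntegral.integral_congr fun t _ => ?_
  refine intervalIntegral.integral_eq_sub_of_hasDerivAt (f := fun s => G (s, t)) (fun s _ => ?_) ?_
  · have h1 : HasFDerivAt G (fderiv ℝ G (s, t)) (s, t) :=
      (hG.differentiable one_ne_zero _).hasFDerivAt
    have h2 : HasDerivAt (fun s : ℝ => (s, t)) ((1 : ℝ), (0 : ℝ)) s :=
      (hasDerivAt_id s).prodMk (hasDerivAt_const s t)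
    exact h1.comp_hasDerivAt s h2
  · exact (hc.comp (by fun_prop : Continuous fun s : ℝ => (s, t))).intervalIntegrable _ _

/-- The other coordinate direction, by reflecting the triangle in its diagonal; this traverses the
hypotenuse in the opposite direction. -/
theorem setIntegral_refTriangle_fderiv_snd {G : ℝ × ℝ → ℝ} (hG : ContDiff ℝ 1 G) :
    ∫ p in refTriangle, fderiv ℝ G p (0, 1) = ∫ t in (0 : ℝ)..1, (G (t, 1 - t) - G (t, 0)) := by
  have hsw : ContDiff ℝ 1 (Prod.swap : ℝ × ℝ → ℝ × ℝ) := contDiff_snd.prodMk contDiff_fst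
  have h := setIntegral_refTriangle_fderiv_fst (hG.comp hsw)
  rw [← setIntegral_refTriangle_swap]
  simp only [Function.comp, Prod.swap_prod_mk] at h
  rw [← h]
  congr 1
  ext p
  have h1 : HasFDerivAt G (fderiv ℝ G p.swap) p.swap :=
    (hG.differentiable one_ne_zero _).hasFDerivAt
  have h2 : HasFDerivAt (Prod.swap : ℝ × ℝ → ℝ × ℝ)
      ((ContinuousLinearMap.snd ℝ ℝ ℝ).prod (ContinuousLinearMap.fst ℝ ℝ ℝ)) p :=
    hasFDerivAt_snd.prodMk hasFDerivAt_fst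
  rw [(h1.comp p h2).fderiv]
  simp

/-! ### Arc length on edges. -/

/-- Integration over a segment with respect to arc length. -/
theorem edgeIntegral_pair {x y : Plane} (hxy : x ≠ y) (g : Plane → ℝ) :
    edgeIntegral {x, y} g = ‖y - x‖ * ∫ t in (0 : ℝ)..1, g (x + t • (y - x)) := by
  have hemb : MeasurableEmbedding (AffineMap.lineMap x y : ℝ → Plane) := by
    refine Continuous.measurableEmbedding (by fun_prop) (AffineMap.lineMap_injective ℝ hxy)
  have hseg : hull {x, y} = AffineMap.lineMap x y '' Set.Icc (0 : ℝ) 1 := by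
    rw [hull, Finset.coe_pair, convexHull_pair, segment_eq_image_lineMap]
  -- Arc length on the segment is the image of Lebesgue measure on [0, 1] under the affine
  -- parametrisation, scaled by the length.
  have hmeas : (Measure.hausdorffMeasure 1 : Measure Plane).restrict (hull {x, y}) =
      nndist x y • ((volume : Measure ℝ).restrict (Set.Icc 0 1)).map (AffineMap.lineMap x y) := by
    ext s hs
    rw [Measure.restrict_apply hs, hseg, Measure.smul_apply, Measure.map_apply hemb.measurable hs,
      Measure.restrict_apply (hemb.measurable hs), Set.inter_comm, ← Set.image_inter_preimage,
      hausdorffMeasure_lineMap_image, hausdorffMeasure_real, Set.inter_comm]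
  rw [edgeIntegral, hmeas, integral_smul_nnreal_measure, hemb.integral_map,
    intervalIntegral.integral_of_le zero_le_one, integral_Icc_eq_integral_Ioc, NNReal.smul_def,
    coe_nndist, dist_comm, dist_eq_norm, smul_eq_mul]
  simp [AffineMap.lineMap_apply, add_comm]

theorem integrableOn_hull_of_continuous {e : Finset Plane} (he : e.card = 2) {g : Plane → ℝ}
    (hg : Continuous g) : IntegrableOn g (hull e) (Measure.hausdorffMeasure 1) := by
  obtain ⟨x, y, -, rfl⟩ := Finset.card_eq_two.1 he
  have hs : hull {x, y} = segment ℝ x y := by rw [hull, Finset.coe_pair, convexHull_pair]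
  have hc : IsCompact (hull {x, y}) := Set.Finite.isCompact_convexHull ℝ (Finset.finite_toSet _)
  have hfin : (Measure.hausdorffMeasure 1 : Measure Plane) (hull {x, y}) < ⊤ := by
    rw [hs, hausdorffMeasure_segment]
    exact edist_lt_top _ _
  obtain ⟨C, hC⟩ := hc.exists_bound_of_continuousOn hg.continuousOn
  have : IsFiniteMeasure ((Measure.hausdorffMeasure 1 : Measure Plane).restrict (hull {x, y})) :=
    ⟨by rwa [Measure.restrict_apply_univ]⟩
  exact Integrable.of_bound hg.aestronglyMeasurable C
    ((ae_restrict_iff' hc.measurableSet).2 (Eventually.of_forall hC))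

/-! ### Triangles and the divergence theorem. -/

/-- The affine map of the reference triangle onto the triangle `abc`. -/
def triangleMap (a b c : Plane) (p : ℝ × ℝ) : Plane := a + (p.1 • (b - a) + p.2 • (c - a))

/-- Twice the signed area of the triangle `abc`. -/
def triangleDet (a b c : Plane) : ℝ := (b 0 - a 0) * (c 1 - a 1) - (b 1 - a 1) * (c 0 - a 0)

theorem hull_triple (a b c : Plane) : hull {a, b, c} = triangleMap a b c '' refTriangle := by
  have hcoe : (({a, b, c} : Finset Plane) : Set Plane) = {a, b, c} := by push_cast; rfl
  rw [hull, hcoe]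
  refine Set.Subset.antisymm (convexHull_min ?_ ?_) ?_
  · rintro x (rfl | rfl | rfl)
    · exact ⟨(0, 0), by simp [refTriangle], by simp [triangleMap]⟩
    · exact ⟨(1, 0), by simp [refTriangle], by simp [triangleMap]⟩
    · exact ⟨(0, 1), by simp [refTriangle], by simp [triangleMap]⟩
  · rintro _ ⟨p, ⟨hp1, hp2, hp3⟩, rfl⟩ _ ⟨q, ⟨hq1, hq2, hq3⟩, rfl⟩ s t hs ht hst
    refine ⟨s • p + t • q, ⟨?_, ?_, ?_⟩, ?_⟩
    · simp; positivity
    · simp; positivity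
    · simp only [Prod.fst_add, Prod.smul_fst, smul_eq_mul, Prod.snd_add, Prod.smul_snd]
      nlinarith
    · obtain rfl : t = 1 - s := by linarith
      simp only [triangleMap, Prod.fst_add, Prod.smul_fst, smul_eq_mul, Prod.snd_add,
        Prod.smul_snd]
      module
  · rintro _ ⟨p, ⟨hp1, hp2, hp3⟩, rfl⟩
    have ha : a ∈ convexHull ℝ ({a, b, c} : Set Plane) := subset_convexHull _ _ (by simp)
    have hb : b ∈ convexHull ℝ ({a, b, c} : Set Plane) := subset_convexHull _ _ (by simp)
    have hc : c ∈ convexHull ℝ ({a, b, c} : Set Plane) := subset_convexHull _ _ (by simp)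
    -- The barycentric coordinates of the point are 1 - p₁ - p₂, p₁, p₂.
    have h := (convex_convexHull ℝ ({a, b, c} : Set Plane)).sum_mem (t := Finset.univ)
      (w := ![1 - p.1 - p.2, p.1, p.2]) (z := ![a, b, c]) ?_ ?_ ?_
    · convert h using 1
      simp only [Fin.sum_univ_three, Matrix.cons_val, triangleMap]
      module
    · intro i _; fin_cases i <;> simp <;> linarith
    · simp only [Fin.sum_univ_three, Matrix.cons_val]; ring
    · intro i _; fin_cases i <;> simp [ha, hb, hc]

/-- If the determinant vanishes, b - a and c - a are parallel; when b ≠ a the ratio is read off in a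
coordinate where b - a does not vanish. -/
theorem triangleDet_ne_zero {a b c : Plane} (h : AffineIndependent ℝ ![a, b, c]) :
    triangleDet a b c ≠ 0 := by
  rw [affineIndependent_iff_not_collinear_set] at h
  intro h0
  apply h
  have hd : (b 0 - a 0) * (c 1 - a 1) = (b 1 - a 1) * (c 0 - a 0) := by
    unfold triangleDet at h0; linarith
  rw [collinear_iff_of_mem (p₀ := a) (by simp)]
  by_cases hab : b = a
  · refine ⟨c - a, ?_⟩
    rintro x (rfl | rfl | rfl)
    · exact ⟨0, by simp⟩
    · exact ⟨0, by simp [hab]⟩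
    · exact ⟨1, by simp⟩
  · refine ⟨b - a, ?_⟩
    rintro x (rfl | rfl | rfl)
    · exact ⟨0, by simp⟩
    · exact ⟨1, by simp⟩
    · by_cases h1 : b 0 - a 0 = 0
      · have h2 : b 1 - a 1 ≠ 0 := by
          intro h2
          apply hab
          ext i
          fin_cases i <;> simp <;> linarith
        refine ⟨(x 1 - a 1) / (b 1 - a 1), ?_⟩
        ext i
        fin_cases i
        · simp only [Fin.zero_eta, vadd_eq_add, PiLp.add_apply, PiLp.smul_apply, PiLp.sub_apply,
            smul_eq_mul, h1, mul_zero]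
          rw [h1, zero_mul] at hd
          have := (mul_eq_zero.1 hd.symm).resolve_left h2
          linarith
        · simp [div_mul_cancel₀ _ h2]
      · refine ⟨(x 0 - a 0) / (b 0 - a 0), ?_⟩
        ext i
        fin_cases i
        · simp [div_mul_cancel₀ _ h1]
        · simp only [Fin.mk_one, vadd_eq_add, PiLp.add_apply, PiLp.smul_apply, PiLp.sub_apply,
            smul_eq_mul]
          field_simp
          linarith

/-- Change of variables with constant Jacobian. The measure preserving identification `E` of the
plane with ℝ × ℝ turns the parametrisation into an affine map of the plane into itself, whose linear
part `L` has a determinant. -/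
theorem setIntegral_hull_triple {a b c : Plane} (hD : triangleDet a b c ≠ 0) (h : Plane → ℝ) :
    ∫ x in hull {a, b, c}, h x =
      |triangleDet a b c| * ∫ p in refTriangle, h (triangleMap a b c p) := by
  let A : Matrix (Fin 2) (Fin 2) ℝ := !![b 0 - a 0, c 0 - a 0; b 1 - a 1, c 1 - a 1]
  let L : Plane →L[ℝ] Plane := (Matrix.toEuclideanLin A).toContinuousLinearMap
  let E : Plane ≃ᵐ ℝ × ℝ :=
    (MeasurableEquiv.toLp 2 (Fin 2 → ℝ)).symm.trans MeasurableEquiv.finTwoArrow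
  have hE : MeasurePreserving E volume volume :=
    (volume_preserving_finTwoArrow ℝ).comp (EuclideanSpace.volume_preserving_symm_measurableEquiv_toLp (Fin 2))
  have hEapp : ∀ x, E x = (x 0, x 1) := fun x => rfl
  have hdet : L.det = triangleDet a b c := by
    change LinearMap.det (Matrix.toEuclideanLin A) = _
    rw [Matrix.toEuclideanLin_eq_toLin_orthonormal, LinearMap.det_toLin, Matrix.det_fin_two_of]
    unfold triangleDet; ring
  have hL : ∀ x, a + L x = triangleMap a b c (E x) := by
    intro x
    ext i
    fin_cases i <;>
      simp [L, A, triangleMap, hEapp, Matrix.toLpLin_apply, dotProduct,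
        Fin.sum_univ_two] <;> ring
  have hinj : Function.Injective fun x => a + L x := by
    intro x y hxy
    have hxy' : L x = L y := add_left_cancel hxy
    have : LinearMap.ker (L : Plane →ₗ[ℝ] Plane) = ⊥ := by
      by_contra hne
      exact (hdet.trans_ne hD) (LinearMap.det_eq_zero_iff_ker_ne_bot.2 hne)
    exact LinearMap.ker_eq_bot.1 this hxy'
  have himg : hull {a, b, c} = (fun x => a + L x) '' (E ⁻¹' refTriangle) := by
    rw [hull_triple]
    simp_rw [hL]
    rw [← Function.comp_def (triangleMap a b c) E, Set.image_comp,
      Set.image_preimage_eq _ E.surjective]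
  rw [himg, integral_image_eq_integral_abs_det_fderiv_smul volume (f' := fun _ => L)
    (E.measurable isCompact_refTriangle.measurableSet) (fun x _ =>
      (L.hasFDerivAt.const_add a).hasFDerivWithinAt) hinj.injOn]
  simp_rw [hL, hdet, smul_eq_mul]
  rw [integral_const_mul]
  congr 1
  exact hE.setIntegral_preimage_emb E.measurableEmbedding (fun p => h (triangleMap a b c p)) _

/-- Twice the area is the base |c - b| times the height, which is the component of b - a along the
unit normal of the base. This is what turns edge integrals over [0, 1] into arc length integrals
carrying the normal. -/
theorem abs_triangleDet_eq {a b c n : Plane} (hn : ‖n‖ = 1) (hperp : inner ℝ n (c - b) = 0)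
    (hout : 0 ≤ inner ℝ n (b - a)) :
    |triangleDet a b c| = ‖c - b‖ * inner ℝ n (b - a) := by
  have hn2 : n 0 ^ 2 + n 1 ^ 2 = 1 := by
    have := EuclideanSpace.real_norm_sq_eq n
    rw [hn, Fin.sum_univ_two] at this
    linarith
  have hw : ‖c - b‖ ^ 2 = (c 0 - b 0) ^ 2 + (c 1 - b 1) ^ 2 := by
    rw [EuclideanSpace.real_norm_sq_eq, Fin.sum_univ_two]; rfl
  have hp : n 0 * (c 0 - b 0) + n 1 * (c 1 - b 1) = 0 := by
    rw [← hperp]; simp [PiLp.inner_apply, Fin.sum_univ_two]; ring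
  have hv : inner ℝ n (b - a) = n 0 * (b 0 - a 0) + n 1 * (b 1 - a 1) := by
    simp [PiLp.inner_apply, Fin.sum_univ_two]; ring
  -- The signed length of the base: c - b is l times the normal rotated by a right angle.
  set l := n 0 * (c 1 - b 1) - n 1 * (c 0 - b 0) with hl
  have h0 : c 0 - b 0 = -(l * n 1) := by
    rw [hl]; linear_combination (-(c 0 - b 0)) * hn2 + n 0 * hp
  have h1 : c 1 - b 1 = l * n 0 := by
    rw [hl]; linear_combination (-(c 1 - b 1)) * hn2 + n 1 * hp
  have hdet : triangleDet a b c = l * inner ℝ n (b - a) := by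
    rw [hv]; unfold triangleDet
    linear_combination (b 0 - a 0) * h1 - (b 1 - a 1) * h0
  have hln : ‖c - b‖ = |l| := by
    rw [← sq_eq_sq₀ (norm_nonneg _) (abs_nonneg _), sq_abs, hw, h0, h1]
    linear_combination l ^ 2 * hn2
  rw [hdet, abs_mul, abs_of_nonneg hout, hln]

/-- Cramer's rule. -/
theorem exists_single_eq_combination {a b c : Plane} (hD : triangleDet a b c ≠ 0) (i : Fin 2) :
    ∃ α β : ℝ, (EuclideanSpace.single i 1 : Plane) = α • (b - a) + β • (c - a) := by
  have hd : triangleDet a b c = (b 0 - a 0) * (c 1 - a 1) - (b 1 - a 1) * (c 0 - a 0) := rfl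
  set d := triangleDet a b c
  fin_cases i
  · refine ⟨(c 1 - a 1) / d, -(b 1 - a 1) / d, ?_⟩
    ext j
    fin_cases j <;> simp <;> field_simp <;> linarith
  · refine ⟨-(c 0 - a 0) / d, (b 0 - a 0) / d, ?_⟩
    ext j
    fin_cases j <;> simp <;> field_simp <;> linarith

/-- Pulled back to the reference triangle, the derivative along α(b - a) + β(c - a) is α∂₁ + β∂₂.
Each partial derivative contributes on the hypotenuse, which maps to the edge bc, and on one leg;
hence the coefficients α + β, -α, -β. -/
theorem setIntegral_hull_triple_fderiv {a b c : Plane} (hD : triangleDet a b c ≠ 0)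
    {G : Plane → ℝ} (hG : ContDiff ℝ 1 G) (α β : ℝ) :
    ∫ x in hull {a, b, c}, fderiv ℝ G x (α • (b - a) + β • (c - a)) =
      |triangleDet a b c| * ((α + β) * (∫ t in (0 : ℝ)..1, G (b + t • (c - b)))
        - α * (∫ t in (0 : ℝ)..1, G (a + t • (c - a)))
        - β * ∫ t in (0 : ℝ)..1, G (a + t • (b - a))) := by
  have hP : ContDiff ℝ 1 (triangleMap a b c) := by unfold triangleMap; fun_prop
  have hGP : ContDiff ℝ 1 (G ∘ triangleMap a b c) := hG.comp hP
  have hPd : ∀ p : ℝ × ℝ, HasFDerivAt (triangleMap a b c)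
      ((ContinuousLinearMap.fst ℝ ℝ ℝ).smulRight (b - a) +
        (ContinuousLinearMap.snd ℝ ℝ ℝ).smulRight (c - a)) p := fun p =>
    ((((ContinuousLinearMap.fst ℝ ℝ ℝ).smulRight (b - a) +
        (ContinuousLinearMap.snd ℝ ℝ ℝ).smulRight (c - a)).hasFDerivAt).const_add a)
  have hd : ∀ p : ℝ × ℝ, fderiv ℝ G (triangleMap a b c p) (α • (b - a) + β • (c - a)) =
      α * fderiv ℝ (G ∘ triangleMap a b c) p (1, 0) +
        β * fderiv ℝ (G ∘ triangleMap a b c) p (0, 1) := by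
    intro p
    rw [(((hG.differentiable one_ne_zero _).hasFDerivAt).comp p (hPd p)).fderiv]
    simp
  have hint : ∀ v, IntegrableOn (fun p => fderiv ℝ (G ∘ triangleMap a b c) p v) refTriangle :=
    fun v => ((hGP.continuous_fderiv one_ne_zero).clm_apply
      continuous_const).continuousOn.integrableOn_compact isCompact_refTriangle
  have hii : ∀ x y : Plane, IntervalIntegrable (fun t : ℝ => G (x + t • y)) volume 0 1 :=
    fun x y => (hG.continuous.comp (by fun_prop)).intervalIntegrable _ _
  have e1 : ∀ t : ℝ, triangleMap a b c (1 - t, t) = b + t • (c - b) := fun t => by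
    simp only [triangleMap]; module
  have e2 : ∀ t : ℝ, triangleMap a b c (0, t) = a + t • (c - a) := fun t => by
    simp only [triangleMap]; module
  have e3 : ∀ t : ℝ, triangleMap a b c (t, 0) = a + t • (b - a) := fun t => by
    simp only [triangleMap]; module
  have e4 : ∀ t : ℝ, triangleMap a b c (t, 1 - t) = b + (1 - t) • (c - b) := fun t => by
    simp only [triangleMap]; module
  have hsub : ∫ t in (0 : ℝ)..1, G (b + (1 - t) • (c - b)) =
      ∫ t in (0 : ℝ)..1, G (b + t • (c - b)) := by
    rw [intervalIntegral.integral_comp_sub_left (fun t => G (b + t • (c - b)))]; simp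
  have hii' : IntervalIntegrable (fun t : ℝ => G (b + (1 - t) • (c - b))) volume 0 1 :=
    (hG.continuous.comp (by fun_prop)).intervalIntegrable _ _
  rw [setIntegral_hull_triple hD]
  simp_rw [hd]
  rw [integral_add ((hint _).const_mul α) ((hint _).const_mul β), integral_const_mul,
    integral_const_mul, setIntegral_refTriangle_fderiv_fst hGP,
    setIntegral_refTriangle_fderiv_snd hGP]
  simp only [Function.comp, e1, e2, e3, e4]
  rw [intervalIntegral.integral_sub (hii _ _) (hii _ _), intervalIntegral.integral_sub hii'
    (hii _ _), hsub]
  ring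

theorem affineIndependent_triple {T : Finset Plane} (hind : AffineIndependent ℝ ((↑) : T → Plane))
    {a b c : Plane} (ha : a ∈ T) (hb : b ∈ T) (hc : c ∈ T) (hab : a ≠ b) (hac : a ≠ c)
    (hbc : b ≠ c) : AffineIndependent ℝ ![a, b, c] := by
  let g : Fin 3 ↪ T := ⟨![⟨a, ha⟩, ⟨b, hb⟩, ⟨c, hc⟩], by
    intro i j hij
    fin_cases i <;> fin_cases j <;> simp_all [Subtype.ext_iff]⟩
  convert hind.comp_embedding g using 1
  ext i : 1
  fin_cases i <;> rfl

/-- The divergence theorem on a triangle. -/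
theorem setIntegral_hull_pd {T : Finset Plane} (hT : T.card = 3)
    (hind : AffineIndependent ℝ ((↑) : T → Plane)) {ν : Finset Plane → Plane}
    (hnorm : ∀ e ∈ T.powersetCard 2, ‖ν e‖ = 1)
    (hperp : ∀ e ∈ T.powersetCard 2, ∀ x ∈ e, ∀ y ∈ e, inner ℝ (ν e) (y - x) = 0)
    (hout : ∀ e ∈ T.powersetCard 2, ∀ x ∈ e, ∀ y ∈ T, inner ℝ (ν e) (y - x) ≤ 0)
    {G : Plane → ℝ} (hG : ContDiff ℝ 1 G) (i : Fin 2) :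
    ∫ x in hull T, pd i G x = ∑ e ∈ T.powersetCard 2, ν e i * edgeIntegral e G := by
  classical
  obtain ⟨a, b, c, hab, hac, hbc, rfl⟩ := Finset.card_eq_three.1 hT
  have hD : triangleDet a b c ≠ 0 := triangleDet_ne_zero
    (affineIndependent_triple hind (by simp) (by simp) (by simp) hab hac hbc)
  have hps : Finset.powersetCard 2 ({a, b, c} : Finset Plane) = {{b, c}, {a, c}, {a, b}} := by
    ext e
    simp only [Finset.mem_powersetCard, Finset.mem_insert, Finset.mem_singleton]
    constructor
    · rintro ⟨hsub, hcard⟩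
      obtain ⟨x, y, hxy, rfl⟩ := Finset.card_eq_two.1 hcard
      have hx := hsub (Finset.mem_insert_self x {y})
      have hy := hsub (Finset.mem_insert_of_mem (Finset.mem_singleton_self y))
      simp only [Finset.mem_insert, Finset.mem_singleton] at hx hy
      rcases hx with rfl | rfl | rfl <;> rcases hy with rfl | rfl | rfl <;>
        simp_all [Finset.pair_comm]
    · rintro (rfl | rfl | rfl)
      · exact ⟨by simp, Finset.card_pair hbc⟩
      · exact ⟨by simp [Finset.insert_subset_iff], Finset.card_pair hac⟩
      · exact ⟨by simp [Finset.insert_subset_iff], Finset.card_pair hab⟩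
  have n1 : ({b, c} : Finset Plane) ≠ {a, c} := fun h => by
    have : b ∈ ({a, c} : Finset Plane) := h ▸ by simp
    simp only [Finset.mem_insert, Finset.mem_singleton] at this
    exact this.elim (fun h => hab h.symm) hbc
  have n2 : ({b, c} : Finset Plane) ≠ {a, b} := fun h => by
    have : c ∈ ({a, b} : Finset Plane) := h ▸ by simp
    simp only [Finset.mem_insert, Finset.mem_singleton] at this
    exact this.elim (fun h => hac h.symm) (fun h => hbc h.symm)
  have n3 : ({a, c} : Finset Plane) ≠ {a, b} := fun h => by
    have : c ∈ ({a, b} : Finset Plane) := h ▸ by simp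
    simp only [Finset.mem_insert, Finset.mem_singleton] at this
    exact this.elim (fun h => hac h.symm) (fun h => hbc h.symm)
  -- With the i-th unit vector expanded in the edge vectors, `hcoord` expresses the i-th component
  -- of any normal through its products with b - a and c - a.
  obtain ⟨α, β, hαβ⟩ := exists_single_eq_combination hD i
  have hcoord : ∀ n : Plane, n i = α * inner ℝ n (b - a) + β * inner ℝ n (c - a) := by
    intro n
    rw [← real_inner_smul_right, ← real_inner_smul_right, ← inner_add_right, ← hαβ,
      EuclideanSpace.inner_single_right]
    simp
  have hneg : ∀ n x y : Plane, inner ℝ n (x - y) = -inner ℝ n (y - x) := by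
    intro n x y; rw [← inner_neg_right, neg_sub]
  rw [hps] at hnorm hperp hout
  have m1 : ({b, c} : Finset Plane) ∈ ({{b, c}, {a, c}, {a, b}} : Finset (Finset Plane)) := by simp
  have m2 : ({a, c} : Finset Plane) ∈ ({{b, c}, {a, c}, {a, b}} : Finset (Finset Plane)) := by simp
  have m3 : ({a, b} : Finset Plane) ∈ ({{b, c}, {a, c}, {a, b}} : Finset (Finset Plane)) := by simp
  -- Base times height with each edge in turn as the base: the normal component times the edge
  -- length is the coefficient of that edge in the volume integral. The outward condition fixes the
  -- sign.
  have k1 : ν {b, c} i * ‖c - b‖ = |triangleDet a b c| * (α + β) := by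
    have hp := hperp _ m1 b (by simp) c (by simp)
    have ho := hout _ m1 b (by simp) a (by simp)
    rw [abs_triangleDet_eq (hnorm _ m1) hp (by rw [hneg]; linarith), hcoord]
    have : inner ℝ (ν {b, c}) (c - a) = inner ℝ (ν {b, c}) (b - a) := by
      rw [← sub_add_sub_cancel c b a, inner_add_right, hp, zero_add]
    rw [this]; ring
  have k2 : ν {a, c} i * ‖c - a‖ = -(|triangleDet a b c| * α) := by
    have hp := hperp _ m2 a (by simp) c (by simp)
    have ho := hout _ m2 a (by simp) b (by simp)
    have hd : |triangleDet a b c| = |triangleDet b a c| := by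
      rw [← abs_neg]; congr 1; unfold triangleDet; ring
    rw [hd, abs_triangleDet_eq (hnorm _ m2) hp (by rw [hneg]; linarith), hcoord, hp,
      hneg _ a b]
    ring
  have k3 : ν {a, b} i * ‖b - a‖ = -(|triangleDet a b c| * β) := by
    have hp := hperp _ m3 a (by simp) b (by simp)
    have ho := hout _ m3 a (by simp) c (by simp)
    have hd : |triangleDet a b c| = |triangleDet c a b| := by
      congr 1; unfold triangleDet; ring
    rw [hd, abs_triangleDet_eq (hnorm _ m3) hp (by rw [hneg]; linarith), hcoord, hp,
      hneg _ a c]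
    ring
  rw [hps, Finset.sum_insert (by simp [n1, n2]), Finset.sum_insert (by simp [n3]),
    Finset.sum_singleton, edgeIntegral_pair hbc, edgeIntegral_pair hac, edgeIntegral_pair hab]
  simp only [pd, hαβ]
  rw [setIntegral_hull_triple_fderiv hD hG]
  rw [← mul_assoc, ← mul_assoc, ← mul_assoc, k1, k2, k3]
  ring

/-! ### The triangles as an almost disjoint cover of the domain. -/

theorem isCompact_hull (s : Finset Plane) : IsCompact (hull s) :=
  Set.Finite.isCompact_convexHull ℝ s.finite_toSet

/-- At most two points have an affine span of dimension at most one, which is null in the plane. -/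
theorem volume_hull_of_card_le_two {s : Finset Plane} (hs : s.card ≤ 2) :
    volume (hull s) = 0 := by
  rcases s.eq_empty_or_nonempty with rfl | hne
  · simp [hull]
  refine measure_mono_null (convexHull_subset_affineSpan (𝕜 := ℝ) (s : Set Plane))
    (Measure.addHaar_affineSubspace _ _ fun htop => ?_)
  have : Nonempty s := hne.to_subtype
  have h := finrank_vectorSpan_range_add_one_le ℝ ((↑) : s → Plane)
  rw [Subtype.range_coe_subtype, Fintype.card_coe] at h
  have hv : vectorSpan ℝ (s : Set Plane) = ⊤ := by
    rw [← direction_affineSpan, htop, AffineSubspace.direction_top]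
  change Module.finrank ℝ (vectorSpan ℝ (s : Set Plane)) + 1 ≤ _ at h
  rw [hv, finrank_top, finrank_euclideanSpace_fin] at h
  omega

namespace Triangulation

variable {Ω : Set Plane} (𝒯 : Triangulation Ω)

theorem mem_triangles {T : Finset Plane} :
    T ∈ 𝒯.triangles ↔ T ∈ 𝒯.complex.faces ∧ T.card = 3 := by
  simp [triangles]

theorem mem_edges {e : Finset Plane} : e ∈ 𝒯.edges ↔ e ∈ 𝒯.complex.faces ∧ e.card = 2 := by
  simp [edges]

theorem mem_edges_of_subset {T e : Finset Plane} (hT : T ∈ 𝒯.triangles)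
    (he : e ∈ T.powersetCard 2) : e ∈ 𝒯.edges := by
  rw [Finset.mem_powersetCard] at he
  exact 𝒯.mem_edges.2 ⟨𝒯.complex.down_closed (𝒯.mem_triangles.1 hT).1 he.1
    (Finset.card_pos.1 (by omega)), he.2⟩

theorem space_eq : 𝒯.complex.space = ⋃ T ∈ 𝒯.triangles, hull T := by
  ext x
  simp only [Geometry.SimplicialComplex.mem_space_iff, Set.mem_iUnion, exists_prop]
  constructor
  · rintro ⟨s, hs, hx⟩
    obtain ⟨T, hT, hsT, hc⟩ := 𝒯.exists_triangle s hs
    exact ⟨T, 𝒯.mem_triangles.2 ⟨hT, hc⟩, convexHull_mono (Finset.coe_subset.2 hsT) hx⟩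
  · rintro ⟨T, hT, hx⟩
    exact ⟨T, (𝒯.mem_triangles.1 hT).1, hx⟩

theorem isOpen_domain (𝒯 : Triangulation Ω) : IsOpen Ω := 𝒯.domain_eq ▸ isOpen_interior

theorem isCompact_space : IsCompact 𝒯.complex.space := by
  rw [space_eq]
  exact 𝒯.triangles.finite_toSet.isCompact_biUnion fun T _ => isCompact_hull T

theorem domain_subset_space : Ω ⊆ 𝒯.complex.space := by
  conv_lhs => rw [𝒯.domain_eq]
  exact interior_subset

/-- A point of a triangle outside Ω lies on the frontier of that triangle, because interior points
of the triangle are interior to the union; the frontier of a convex set is null. -/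
theorem domain_ae_eq : Ω =ᵐ[volume] ⋃ T ∈ 𝒯.triangles, hull T := by
  rw [← space_eq]
  refine (LE.le.eventuallyLE 𝒯.domain_subset_space).antisymm ?_
  rw [ae_le_set]
  refine measure_mono_null (t := ⋃ T ∈ 𝒯.triangles, frontier (hull T)) ?_ ?_
  · rintro x ⟨hx, hxΩ⟩
    rw [space_eq] at hx
    simp only [Set.mem_iUnion, exists_prop] at hx ⊢
    obtain ⟨T, hT, hxT⟩ := hx
    refine ⟨T, hT, subset_closure hxT, fun hxi => hxΩ ?_⟩
    rw [𝒯.domain_eq]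
    exact interior_mono
      (Geometry.SimplicialComplex.convexHull_subset_space (𝒯.mem_triangles.1 hT).1) hxi
  · refine (measure_biUnion_null_iff 𝒯.triangles.countable_toSet).2 fun T _ => ?_
    exact (convex_convexHull ℝ _).addHaar_frontier volume

theorem hull_ae_le_domain {T : Finset Plane} (hT : T ∈ 𝒯.triangles) : hull T ≤ᵐ[volume] Ω :=
  (LE.le.eventuallyLE (Set.subset_biUnion_of_mem (u := hull)
    (Finset.mem_coe.2 hT))).trans 𝒯.domain_ae_eq.symm.le

theorem isFiniteMeasure_restrict_domain (𝒯 : Triangulation Ω) :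
    IsFiniteMeasure (volume.restrict Ω) :=
  ⟨by
    rw [Measure.restrict_apply_univ]
    exact (measure_mono 𝒯.domain_subset_space).trans_lt 𝒯.isCompact_space.measure_lt_top⟩

theorem inter_hull_subset {T T' : Finset Plane} (hT : T ∈ 𝒯.triangles) (hT' : T' ∈ 𝒯.triangles)
    {s : Finset Plane} (hs : ∀ x ∈ T, x ∈ T' → x ∈ s) : hull T ∩ hull T' ⊆ hull s :=
  (𝒯.complex.inter_subset_convexHull (𝒯.mem_triangles.1 hT).1 (𝒯.mem_triangles.1 hT').1).trans
    (convexHull_mono fun x hx => hs x hx.1 hx.2)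

/-- By conformity the intersection lies in the hull of the common vertices, and two distinct
triangles share at most two. -/
theorem aedisjoint_hull {T T' : Finset Plane} (hT : T ∈ 𝒯.triangles) (hT' : T' ∈ 𝒯.triangles)
    (hne : T ≠ T') : AEDisjoint volume (hull T) (hull T') := by
  classical
  refine measure_mono_null (𝒯.inter_hull_subset hT hT' (s := T ∩ T') (by simp +contextual))
    (volume_hull_of_card_le_two ?_)
  by_contra hlt
  have hc := (𝒯.mem_triangles.1 hT).2
  have hc' := (𝒯.mem_triangles.1 hT').2
  have h1 : T ∩ T' = T := Finset.eq_of_subset_of_card_le Finset.inter_subset_left (by omega)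
  have h2 : T ∩ T' = T' := Finset.eq_of_subset_of_card_le Finset.inter_subset_right (by omega)
  exact hne (h1.symm.trans h2)

/-- An integral over the domain is the sum of the integrals over the triangles. -/
theorem setIntegral_domain {f : Plane → ℝ} (hf : IntegrableOn f Ω) :
    ∫ x in Ω, f x = ∑ T ∈ 𝒯.triangles, ∫ x in hull T, f x := by
  have hU : (⋃ T ∈ 𝒯.triangles, hull T) = ⋃ T : 𝒯.triangles, hull (T : Finset Plane) := by
    rw [Set.iUnion_subtype]
  rw [setIntegral_congr_set 𝒯.domain_ae_eq, hU, integral_iUnion_ae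
    (fun T => (isCompact_hull _).measurableSet.nullMeasurableSet), tsum_fintype,
    Finset.sum_coe_sort 𝒯.triangles (fun T => ∫ x in hull T, f x)]
  · exact fun T T' hne => 𝒯.aedisjoint_hull T.2 T'.2 fun h => hne (Subtype.ext h)
  · rw [← hU]
    exact hf.congr_set_ae 𝒯.domain_ae_eq.symm

end Triangulation

/-! ### Orientation of the edge normals and summation over the mesh. -/

/-- Two triangles `abc`, `abd` on the same side of the line `ab` overlap off this line. -/
theorem exists_mem_hull_inter {a b c d n : Plane} (hD : triangleDet a b c ≠ 0)
    (hab : inner ℝ n (b - a) = 0) (hc : inner ℝ n (c - a) < 0) (hd : inner ℝ n (d - a) < 0) :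
    ∃ z ∈ hull {a, b, c} ∩ hull {a, b, d}, inner ℝ n (z - a) < 0 := by
  obtain ⟨β, γ, hβγ⟩ : ∃ β γ : ℝ, d - a = β • (b - a) + γ • (c - a) := by
    obtain ⟨α₀, β₀, h₀⟩ := exists_single_eq_combination hD 0
    obtain ⟨α₁, β₁, h₁⟩ := exists_single_eq_combination hD 1
    refine ⟨(d - a) 0 * α₀ + (d - a) 1 * α₁, (d - a) 0 * β₀ + (d - a) 1 * β₁, ?_⟩
    have h : d - a = (d - a) 0 • EuclideanSpace.single 0 1 + (d - a) 1 • EuclideanSpace.single 1 1 := by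
      ext i; fin_cases i <;> simp
    rw [h₀, h₁] at h
    conv_lhs => rw [h]
    module
  -- Both c and d lie strictly on the negative side of ab, so d - a has a positive component along c
  -- - a.
  have hγ : 0 < γ := by
    rw [hβγ, inner_add_right, real_inner_smul_right, real_inner_smul_right, hab] at hd
    nlinarith
  -- The common point is obtained by moving from the midpoint of ab slightly towards d. This ε is
  -- small enough for its coordinates ((1 - ε)/2 + εβ, εγ) with respect to abc to stay in the
  -- reference triangle.
  set ε : ℝ := 1 / (2 * (1 + |β| + γ)) with hε
  have hden : 0 < 2 * (1 + |β| + γ) := by positivity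
  have hεpos : 0 < ε := by positivity
  have hε1 : ε * (2 * (1 + |β| + γ)) = 1 := by rw [hε]; field_simp
  have hβ1 := le_abs_self β
  have hβ2 := neg_abs_le β
  have e1 : 0 ≤ ε * (|β| - β) := mul_nonneg hεpos.le (by linarith)
  have e2 : 0 ≤ ε * (|β| + β) := mul_nonneg hεpos.le (by linarith)
  have e3 : 0 < ε * γ := mul_pos hεpos hγ
  have e4 : 0 ≤ ε * |β| := by positivity
  refine ⟨a + ((1 - ε) / 2) • (b - a) + ε • (d - a), ⟨?_, ?_⟩, ?_⟩
  · rw [hull_triple]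
    refine ⟨((1 - ε) / 2 + ε * β, ε * γ), ⟨?_, ?_, ?_⟩, ?_⟩
    · simp only; nlinarith
    · simp only; nlinarith
    · simp only; nlinarith
    · rw [hβγ, triangleMap]; module
  · rw [hull_triple]
    refine ⟨((1 - ε) / 2, ε), ⟨?_, ?_, ?_⟩, ?_⟩
    · simp only; nlinarith
    · exact hεpos.le
    · simp only; nlinarith
    · rw [triangleMap]; module
  · have : a + ((1 - ε) / 2) • (b - a) + ε • (d - a) - a =
        ((1 - ε) / 2) • (b - a) + ε • (d - a) := by module
    rw [this, inner_add_right, real_inner_smul_right, real_inner_smul_right, hab]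
    nlinarith

theorem inner_sub_eq_zero_of_mem_hull {e : Finset Plane} {n a z : Plane}
    (h : ∀ y ∈ e, inner ℝ n (y - a) = 0) (hz : z ∈ hull e) : inner ℝ n (z - a) = 0 := by
  have hconv : Convex ℝ {y : Plane | inner ℝ n (y - a) = 0} := by
    have : {y : Plane | inner ℝ n (y - a) = 0} = {y | innerSL ℝ n y = inner ℝ n a} := by
      ext y; simp [inner_sub_right, sub_eq_zero]
    rw [this]
    exact convex_hyperplane (innerSL ℝ n).toLinearMap.isLinear _
  exact convexHull_min (fun y hy => h y hy) hconv hz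

theorem exists_eq_triple {T : Finset Plane} (hT : T.card = 3) {a b : Plane} (hab : a ≠ b)
    (he : {a, b} ⊆ T) : ∃ c, c ≠ a ∧ c ≠ b ∧ T = {a, b, c} := by
  classical
  have hcard : (T \ {a, b}).card = 1 := by
    rw [Finset.card_sdiff_of_subset he, hT, Finset.card_pair hab]
  obtain ⟨c, hc⟩ := Finset.card_eq_one.1 hcard
  have hcm : c ∈ T \ {a, b} := hc ▸ Finset.mem_singleton_self c
  simp only [Finset.mem_sdiff, Finset.mem_insert, Finset.mem_singleton, not_or] at hcm
  refine ⟨c, hcm.2.1, hcm.2.2, ?_⟩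
  have := Finset.sdiff_union_of_subset he
  rw [hc] at this
  rw [← this]
  ext x; simp only [Finset.mem_union, Finset.mem_insert, Finset.mem_singleton]; tauto

/-- A triangle of height zero has no area. -/
theorem triangleDet_eq_zero_of_inner {a b c n : Plane} (hn : ‖n‖ = 1)
    (hab : inner ℝ n (b - a) = 0) (hac : inner ℝ n (c - a) = 0) : triangleDet a b c = 0 := by
  have hcb : inner ℝ n (c - b) = 0 := by
    rw [← sub_sub_sub_cancel_right c b a, inner_sub_right, hab, hac, sub_zero]
  have := abs_triangleDet_eq hn hcb hab.ge
  rw [hab, mul_zero] at this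
  exact abs_eq_zero.1 this

namespace EdgeFrame

variable {Ω : Set Plane} {𝒯 : Triangulation Ω} (F : EdgeFrame 𝒯)

theorem mem_minus {e T : Finset Plane} :
    T ∈ F.minus e ↔ T ∈ 𝒯.triangles ∧ e ⊆ T ∧ T ≠ F.plus e := by
  simp [minus]

/-- The normal of an edge points into the adjacent triangles other than `K₊`. -/
theorem n_inward {e T : Finset Plane} (he : e ∈ 𝒯.edges) (hT : T ∈ F.minus e) {x y : Plane}
    (hx : x ∈ e) (hy : y ∈ T) : 0 ≤ inner ℝ (F.n e) (y - x) := by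
  obtain ⟨hTt, heT, hne⟩ := F.mem_minus.1 hT
  obtain ⟨hTf, hTc⟩ := 𝒯.mem_triangles.1 hTt
  obtain ⟨hPf, hPc⟩ := 𝒯.mem_triangles.1 (F.plus_mem e he)
  obtain ⟨b, hbx, hb⟩ : ∃ b, x ≠ b ∧ e = {x, b} := by
    obtain ⟨p, q, hpq, rfl⟩ := Finset.card_eq_two.1 (𝒯.mem_edges.1 he).2
    simp only [Finset.mem_insert, Finset.mem_singleton] at hx
    rcases hx with rfl | rfl
    · exact ⟨q, hpq, rfl⟩
    · exact ⟨p, hpq.symm, Finset.pair_comm _ _⟩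
  have hbe : b ∈ e := by rw [hb]; simp
  by_cases hye : y ∈ e
  · exact (F.n_perp e he x hx y hye).ge
  obtain ⟨c, hcx, hcb, hP⟩ := exists_eq_triple hPc hbx (hb ▸ F.subset_plus e he)
  obtain ⟨d, hdx, hdb, hTd⟩ := exists_eq_triple hTc hbx (hb ▸ heT)
  have hyd : y = d := by
    rw [hTd] at hy
    rw [hb] at hye
    simp only [Finset.mem_insert, Finset.mem_singleton] at hy hye
    tauto
  subst hyd
  -- Otherwise both triangles lie on the negative side of e and share a point off its line, whereas
  -- conformity puts all their common points into e.
  by_contra! hlt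
  have hnb := F.n_perp e he x hx b hbe
  have hD : triangleDet x b c ≠ 0 := by
    refine triangleDet_ne_zero (affineIndependent_triple (𝒯.complex.indep hPf) ?_ ?_ ?_ hbx hcx.symm
      hcb.symm) <;> simp [hP]
  have hcle := F.n_outward e he x hx c (by simp [hP])
  have hclt : inner ℝ (F.n e) (c - x) < 0 := lt_of_le_of_ne hcle fun h =>
    hD (triangleDet_eq_zero_of_inner (F.norm_n e he) hnb h)
  obtain ⟨z, hz, hzn⟩ := exists_mem_hull_inter hD hnb hclt hlt
  rw [← hP, ← hTd] at hz
  -- The third vertices differ, since otherwise T would be K₊; so the only common vertices are those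
  -- of e.
  have hcy : c ≠ y := fun h => hne (by rw [hTd, hP, h])
  have hze : z ∈ hull e := by
    refine 𝒯.inter_hull_subset (F.plus_mem e he) hTt (fun p hp hp' => ?_) hz
    rw [hP] at hp
    rw [hTd] at hp'
    rw [hb]
    simp only [Finset.mem_insert, Finset.mem_singleton] at hp hp' ⊢
    rcases hp with h | h | h
    · exact Or.inl h
    · exact Or.inr h
    · rcases hp' with h' | h' | h'
      · exact Or.inl h'
      · exact Or.inr h'
      · exact absurd (h.symm.trans h') hcy
  rw [inner_sub_eq_zero_of_mem_hull (fun y hy => F.n_perp e he x hx y hy) hze] at hzn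
  exact lt_irrefl _ hzn

open Classical in
/-- The normal on the edge `e` that points out of the adjacent triangle `T`. -/
def outer (T e : Finset Plane) : Plane := if T = F.plus e then F.n e else -F.n e

theorem edgeIntegral_jump {e : Finset Plane} (he : e ∈ 𝒯.edges) {G : Finset Plane → Plane → ℝ}
    (hG : ∀ T, Continuous (G T)) :
    edgeIntegral e (F.jump G e) =
      edgeIntegral e (G (F.plus e)) - ∑ T ∈ F.minus e, edgeIntegral e (G T) := by
  have hi : ∀ T, IntegrableOn (G T) (hull e) (Measure.hausdorffMeasure 1) := fun T =>
    integrableOn_hull_of_continuous (𝒯.mem_edges.1 he).2 (hG T)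
  simp only [edgeIntegral, jump]
  rw [integral_sub (hi _) (integrable_finsetSum _ fun T _ => hi T),
    integral_finsetSum _ fun T _ => hi T]

/-- Exchange of the order of summation: the pairs of vertices of T are the mesh edges contained in
T, as faces of simplices belong to the complex. K₊ is split off from the other triangles at e, whose
number plays no role. -/
theorem sum_triangles_sum_edges (X : Finset Plane → Finset Plane → ℝ) :
    ∑ T ∈ 𝒯.triangles, ∑ e ∈ T.powersetCard 2, X T e =
      ∑ e ∈ 𝒯.edges, (X (F.plus e) e + ∑ T ∈ F.minus e, X T e) := by
  classical
  rw [Finset.sum_comm' (s := 𝒯.triangles) (t := fun T => T.powersetCard 2) (t' := 𝒯.edges)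
    (s' := fun e => {T ∈ 𝒯.triangles | e ⊆ T})]
  · refine Finset.sum_congr rfl fun e he => ?_
    have : ({T ∈ 𝒯.triangles | e ⊆ T} : Finset _) = insert (F.plus e) (F.minus e) := by
      ext T
      simp only [Finset.mem_filter, Finset.mem_insert, F.mem_minus]
      constructor
      · rintro ⟨h1, h2⟩
        by_cases h : T = F.plus e
        · exact Or.inl h
        · exact Or.inr ⟨h1, h2, h⟩
      · rintro (rfl | ⟨h1, h2, -⟩)
        · exact ⟨F.plus_mem e he, F.subset_plus e he⟩
        · exact ⟨h1, h2⟩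
    rw [this, Finset.sum_insert (by simp [F.mem_minus])]
  · intro T e
    simp only [Finset.mem_filter]
    constructor
    · rintro ⟨hT, he⟩
      exact ⟨⟨hT, (Finset.mem_powersetCard.1 he).1⟩, 𝒯.mem_edges_of_subset hT he⟩
    · rintro ⟨⟨hT, heT⟩, he⟩
      exact ⟨hT, Finset.mem_powersetCard.2 ⟨heT, (𝒯.mem_edges.1 he).2⟩⟩

/-- The divergence theorem on the mesh. -/
theorem sum_setIntegral_pd {G : Finset Plane → Plane → ℝ} (hG : ∀ T, ContDiff ℝ 1 (G T))
    (i : Fin 2) :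
    ∑ T ∈ 𝒯.triangles, ∫ x in hull T, pd i (G T) x =
      ∑ e ∈ 𝒯.edges, F.n e i * edgeIntegral e (F.jump G e) := by
  have h : ∀ T ∈ 𝒯.triangles, ∫ x in hull T, pd i (G T) x =
      ∑ e ∈ T.powersetCard 2, F.outer T e i * edgeIntegral e (G T) := by
    intro T hT
    obtain ⟨hTf, hTc⟩ := 𝒯.mem_triangles.1 hT
    have hmem : ∀ e ∈ T.powersetCard 2, e ∈ 𝒯.edges := fun e he => 𝒯.mem_edges_of_subset hT he
    refine setIntegral_hull_pd hTc (𝒯.complex.indep hTf) (ν := F.outer T) ?_ ?_ ?_ (hG T) i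
    · intro e he
      unfold outer
      split_ifs <;> simp [F.norm_n e (hmem e he)]
    · intro e he x hx y hy
      unfold outer
      split_ifs
      · exact F.n_perp e (hmem e he) x hx y hy
      · rw [inner_neg_left, F.n_perp e (hmem e he) x hx y hy, neg_zero]
    · intro e he x hx y hy
      unfold outer
      split_ifs with hp
      · exact F.n_outward e (hmem e he) x hx y (hp ▸ hy)
      · rw [inner_neg_left, neg_nonpos]
        exact F.n_inward (hmem e he)
          (F.mem_minus.2 ⟨hT, (Finset.mem_powersetCard.1 he).1, hp⟩) hx hy
  rw [Finset.sum_congr rfl h, F.sum_triangles_sum_edges]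
  refine Finset.sum_congr rfl fun e he => ?_
  -- On the triangles other than K₊ the outer normal is -n_e, which supplies the minus sign of the
  -- jump.
  have hm : ∑ T ∈ F.minus e, F.outer T e i * edgeIntegral e (G T) =
      ∑ T ∈ F.minus e, -(F.n e i * edgeIntegral e (G T)) := by
    refine Finset.sum_congr rfl fun T hT => ?_
    rw [outer, if_neg (F.mem_minus.1 hT).2.2]
    simp
  rw [F.edgeIntegral_jump he fun T => (hG T).continuous, hm, outer, if_pos rfl,
    Finset.sum_neg_distrib, ← Finset.mul_sum]
  ring

end EdgeFrame

/-! ### Derivatives -/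

theorem contDiff_pd {φ : Plane → ℝ} (hφ : ContDiff ℝ ∞ φ) (i : Fin 2) : ContDiff ℝ ∞ (pd i φ) :=
  (hφ.fderiv_right (m := ∞) (by simp)).clm_apply contDiff_const

theorem pd_mul {f g : Plane → ℝ} (hf : Differentiable ℝ f) (hg : Differentiable ℝ g) (i : Fin 2)
    (x : Plane) : pd i (fun y => f y * g y) x = pd i f x * g x + f x * pd i g x := by
  simp only [pd]
  rw [fderiv_fun_mul (hf x) (hg x)]
  simp; ring

theorem pd_comm {φ : Plane → ℝ} (hφ : ContDiff ℝ ∞ φ) (i j : Fin 2) (x : Plane) :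
    pd i (pd j φ) x = pd j (pd i φ) x := by
  have hd : DifferentiableAt ℝ (fderiv ℝ φ) x :=
    ((hφ.fderiv_right (m := ∞) (by simp)).differentiable (by simp)) x
  have h : ∀ v w : Plane, fderiv ℝ (fun y => fderiv ℝ φ y v) x w = fderiv ℝ (fderiv ℝ φ) x w v := by
    intro v w
    rw [fderiv_clm_apply hd (differentiableAt_const v)]
    simp
  have hs : IsSymmSndFDerivAt ℝ φ x :=
    hφ.contDiffAt.isSymmSndFDerivAt (by
      rw [minSmoothness_of_isRCLikeNormedField]; exact WithTop.coe_le_coe.2 (le_top : (2 : ℕ∞) ≤ ⊤))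
  simp only [pd]
  change fderiv ℝ (fun y => fderiv ℝ φ y _) x _ = fderiv ℝ (fun y => fderiv ℝ φ y _) x _
  rw [h, h]
  exact hs _ _

theorem hasFDerivAt_coord (i : Fin 2) (x : Plane) :
    HasFDerivAt (fun y : Plane => y i) (EuclideanSpace.proj i : Plane →L[ℝ] ℝ) x :=
  (EuclideanSpace.proj i : Plane →L[ℝ] ℝ).hasFDerivAt

theorem contDiff_eval (p : MvPolynomial (Fin 2) ℝ) :
    ContDiff ℝ ∞ fun x : Plane => MvPolynomial.eval (fun i => x i) p := by
  induction p using MvPolynomial.induction_on with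
  | C a => simpa using contDiff_const
  | add p q hp hq => simpa using hp.add hq
  | mul_X p i hp =>
    simpa using hp.mul (EuclideanSpace.proj i : Plane →L[ℝ] ℝ).contDiff

theorem pd_eval (p : MvPolynomial (Fin 2) ℝ) (i : Fin 2) (x : Plane) :
    pd i (fun y : Plane => MvPolynomial.eval (fun j => y j) p) x =
      MvPolynomial.eval (fun j => x j) (MvPolynomial.pderiv i p) := by
  induction p using MvPolynomial.induction_on with
  | C a => simp [pd]
  | add p q hp hq =>
    simp only [pd] at hp hq ⊢
    simp only [map_add]
    rw [fderiv_fun_add ((contDiff_eval p).differentiable (by simp) x)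
      ((contDiff_eval q).differentiable (by simp) x), ← hp, ← hq]
    rfl
  | mul_X p j hp =>
    simp only [map_mul, MvPolynomial.eval_X, MvPolynomial.pderiv_mul, map_add]
    rw [pd_mul ((contDiff_eval p).differentiable (by simp))
      (fun y => (hasFDerivAt_coord j y).differentiableAt), hp]
    have : pd i (fun y : Plane => y j) x =
        MvPolynomial.eval (fun k => x k) (MvPolynomial.pderiv i (MvPolynomial.X j)) := by
      rw [pd, (hasFDerivAt_coord j x).fderiv, MvPolynomial.pderiv_X]
      by_cases hij : j = i
      · subst hij; simp
      · simp [hij]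
    rw [this]

/-- A polynomial over ℝ is determined by its values, so the symmetry of second derivatives of smooth
functions carries over. -/
theorem pderiv_pderiv_comm (p : MvPolynomial (Fin 2) ℝ) (i j : Fin 2) :
    MvPolynomial.pderiv i (MvPolynomial.pderiv j p) =
      MvPolynomial.pderiv j (MvPolynomial.pderiv i p) := by
  refine MvPolynomial.funext fun y => ?_
  have hx : (fun k => (WithLp.toLp 2 y : Plane) k) = y := rfl
  have h := pd_comm (contDiff_eval p) i j (WithLp.toLp 2 y)
  have hp : ∀ k, pd k (fun z : Plane => MvPolynomial.eval (fun l => z l) p) =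
      fun z : Plane => MvPolynomial.eval (fun l => z l) (MvPolynomial.pderiv k p) :=
    fun k => funext fun z => pd_eval p k z
  rw [hp, hp, pd_eval, pd_eval, hx] at h
  exact h

/-! ### Green's formula on the mesh -/

namespace EdgeFrame

variable {Ω : Set Plane} {𝒯 : Triangulation Ω} (F : EdgeFrame 𝒯)

theorem continuous_jump {P : Finset Plane → Plane → ℝ} (hP : ∀ T, Continuous (P T))
    (e : Finset Plane) : Continuous (F.jump P e) :=
  (hP _).sub (continuous_finsetSum _ fun T _ => hP T)

theorem jump_mul_right (P : Finset Plane → Plane → ℝ) (g : Plane → ℝ) (e : Finset Plane)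
    (x : Plane) : F.jump (fun T y => P T y * g y) e x = F.jump P e x * g x := by
  simp only [jump, sub_mul, Finset.sum_mul]

/-- Green's formula on the mesh for a smooth vector field. -/
theorem sum_setIntegral_div {P : Finset Plane → Plane → ℝ} (hP : ∀ T, ContDiff ℝ ∞ (P T))
    {Φ : Fin 2 → Plane → ℝ} (hΦ : ∀ i, ContDiff ℝ ∞ (Φ i)) :
    ∑ T ∈ 𝒯.triangles, ∫ x in hull T,
        (∑ i, pd i (P T) x * Φ i x + P T x * ∑ i, pd i (Φ i) x) =
      ∑ e ∈ 𝒯.edges, edgeIntegral e fun x => F.jump P e x * ∑ i, Φ i x * F.n e i := by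
  -- The divergence theorem is applied to each product P_T Φᵢ separately, and the product rule
  -- recombines the volume terms.
  have hPΦ : ∀ i T, ContDiff ℝ ∞ fun y => P T y * Φ i y := fun i T => (hP T).mul (hΦ i)
  have hint : ∀ i T, IntegrableOn (pd i fun y => P T y * Φ i y) (hull T) := fun i T =>
    (contDiff_pd (hPΦ i T) i).continuous.continuousOn.integrableOn_compact (isCompact_hull T)
  have hl : ∀ T, ∫ x in hull T, (∑ i, pd i (P T) x * Φ i x + P T x * ∑ i, pd i (Φ i) x) =
      ∑ i, ∫ x in hull T, pd i (fun y => P T y * Φ i y) x := by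
    intro T
    rw [← integral_finsetSum _ fun i _ => hint i T]
    refine integral_congr_ae (Eventually.of_forall fun x => ?_)
    simp only [Finset.mul_sum, ← Finset.sum_add_distrib]
    exact Finset.sum_congr rfl fun i _ => (pd_mul ((hP T).differentiable (by simp))
      ((hΦ i).differentiable (by simp)) i x).symm
  have hr : ∀ e ∈ 𝒯.edges, (edgeIntegral e fun x => F.jump P e x * ∑ i, Φ i x * F.n e i) =
      ∑ i, F.n e i * edgeIntegral e (F.jump (fun T y => P T y * Φ i y) e) := by
    intro e he
    simp only [edgeIntegral, ← integral_const_mul]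
    rw [← integral_finsetSum]
    · refine integral_congr_ae (Eventually.of_forall fun x => ?_)
      simp only [F.jump_mul_right, Finset.mul_sum]
      exact Finset.sum_congr rfl fun i _ => by ring
    · intro i _
      exact (integrableOn_hull_of_continuous (𝒯.mem_edges.1 he).2
        (F.continuous_jump (fun T => (hPΦ i T).continuous) e)).const_mul _
  rw [Finset.sum_congr rfl fun T _ => hl T, Finset.sum_congr rfl hr, Finset.sum_comm,
    Finset.sum_comm (s := 𝒯.edges)]
  exact Finset.sum_congr rfl fun i _ =>
    F.sum_setIntegral_pd (fun T => (hPΦ i T).of_le (by exact_mod_cast le_top)) i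

end EdgeFrame

/-! ### Passing to the limit -/

/-- The common limit principle for volume and edge terms: the difference of the integrals is at most
C ∫ d_m. Only the dominating functions, not `f m - f₀` itself, need to be tested for convergence. -/
theorem tendsto_integral_of_abs_sub_le {α : Type*} [MeasurableSpace α] {μ : Measure α}
    {f d : ℕ → α → ℝ} {f₀ : α → ℝ} {C : ℝ} (hf : ∀ m, Integrable (f m) μ) (hf₀ : Integrable f₀ μ)
    (hd : ∀ m, Integrable (d m) μ) (hle : ∀ m, ∀ᵐ x ∂μ, |f m x - f₀ x| ≤ C * d m x)
    (hlim : Tendsto (fun m => ∫ x, d m x ∂μ) atTop (𝓝 0)) :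
    Tendsto (fun m => ∫ x, f m x ∂μ) atTop (𝓝 (∫ x, f₀ x ∂μ)) := by
  rw [tendsto_iff_norm_sub_tendsto_zero]
  refine squeeze_zero (fun _ => norm_nonneg _) (fun m => ?_) (by simpa using hlim.const_mul C)
  rw [← integral_sub (hf m) hf₀, ← integral_const_mul]
  exact norm_integral_le_of_norm_le ((hd m).const_mul C) (hle m)

theorem integrableOn_mul_of_bounded {A U : Set Plane} (hAU : A ≤ᵐ[volume] U)
    (hA : MeasurableSet A) {g f : Plane → ℝ} (hg : Continuous g) {C : ℝ}
    (hC : ∀ x ∈ A, |g x| ≤ C) (hf : IntegrableOn f U) :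
    IntegrableOn (fun x => g x * f x) A :=
  (hf.mono_set_ae hAU).bdd_mul hg.aestronglyMeasurable
    ((ae_restrict_iff' hA).2 (Eventually.of_forall hC))

theorem tendsto_setIntegral_mul {A U : Set Plane} (hAU : A ≤ᵐ[volume] U) (hA : MeasurableSet A)
    {f : ℕ → Plane → ℝ} {f₀ g : Plane → ℝ} (hf : ∀ m, IntegrableOn (f m) U)
    (hf₀ : IntegrableOn f₀ U)
    (hlim : Tendsto (fun m => ∫ x in U, |f m x - f₀ x|) atTop (𝓝 0)) (hg : Continuous g) {C : ℝ}
    (hC : ∀ x ∈ A, |g x| ≤ C) :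
    Tendsto (fun m => ∫ x in A, g x * f m x) atTop (𝓝 (∫ x in A, g x * f₀ x)) := by
  have hi : ∀ m, IntegrableOn (fun x => |f m x - f₀ x|) U := fun m => ((hf m).sub hf₀).abs
  refine tendsto_integral_of_abs_sub_le (C := C) (d := fun m x => |f m x - f₀ x|)
    (fun m => integrableOn_mul_of_bounded hAU hA hg hC (hf m))
    (integrableOn_mul_of_bounded hAU hA hg hC hf₀) (fun m => (hi m).mono_set_ae hAU)
    (fun m => (ae_restrict_iff' hA).2 (Eventually.of_forall fun x hx => ?_)) ?_
  · rw [← mul_sub, abs_mul]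
    exact mul_le_mul_of_nonneg_right (hC x hx) (abs_nonneg _)
  · exact squeeze_zero (fun m => integral_nonneg fun x => abs_nonneg _)
      (fun m => setIntegral_mono_set (hi m) (Eventually.of_forall fun x => abs_nonneg _) hAU) hlim

/-- The volume terms of Green's formula are continuous under `L¹` convergence of the vector field
and of its divergence. -/
theorem tendsto_setIntegral_green {A U K : Set Plane} (hAU : A ≤ᵐ[volume] U)
    (hA : MeasurableSet A) (hK : IsCompact K) (hUK : U ⊆ K) {Φ : ℕ → Fin 2 → Plane → ℝ}
    {q : Fin 2 → Plane → ℝ} {r : Plane → ℝ} (hq : ∀ i, IntegrableOn (q i) U)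
    (hr : IntegrableOn r U) (hΦ : ∀ m i, ContDiff ℝ ∞ (Φ m i))
    (hlim : ∀ i, Tendsto (fun m => ∫ x in U, |Φ m i x - q i x|) atTop (𝓝 0))
    (hlimr : Tendsto (fun m => ∫ x in U, |(∑ i, pd i (Φ m i) x) - r x|) atTop (𝓝 0))
    {g : Plane → ℝ} (hg : ContDiff ℝ ∞ g) {C : ℝ} (hC : ∀ x ∈ A, |g x| ≤ C)
    (hC' : ∀ i, ∀ x ∈ A, |pd i g x| ≤ C) :
    Tendsto (fun m => ∫ x in A, (∑ i, pd i g x * Φ m i x + g x * ∑ i, pd i (Φ m i) x)) atTop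
      (𝓝 (∫ x in A, (∑ i, pd i g x * q i x + g x * r x))) := by
  have hcont : ∀ {f : Plane → ℝ}, Continuous f → IntegrableOn f U := fun hf =>
    (hf.continuousOn.integrableOn_compact hK).mono_set hUK
  have hpc : ∀ i, Continuous (pd i g) := fun i => (contDiff_pd hg i).continuous
  have hdc : ∀ m, Continuous fun x => ∑ i, pd i (Φ m i) x := fun m =>
    continuous_finsetSum _ fun i _ => (contDiff_pd (hΦ m i) i).continuous
  have hi1 : ∀ m i, IntegrableOn (fun x => pd i g x * Φ m i x) A := fun m i =>
    integrableOn_mul_of_bounded hAU hA (hpc i) (hC' i) (hcont (hΦ m i).continuous)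
  have hi2 : ∀ i, IntegrableOn (fun x => pd i g x * q i x) A := fun i =>
    integrableOn_mul_of_bounded hAU hA (hpc i) (hC' i) (hq i)
  have hi3 : ∀ m, IntegrableOn (fun x => g x * ∑ i, pd i (Φ m i) x) A := fun m =>
    integrableOn_mul_of_bounded hAU hA hg.continuous hC (hcont (hdc m))
  have hi4 : IntegrableOn (fun x => g x * r x) A :=
    integrableOn_mul_of_bounded hAU hA hg.continuous hC hr
  have e1 : ∀ m, ∫ x in A, (∑ i, pd i g x * Φ m i x + g x * ∑ i, pd i (Φ m i) x) =
      ∑ i, (∫ x in A, pd i g x * Φ m i x) + ∫ x in A, g x * ∑ i, pd i (Φ m i) x := fun m => by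
    rw [integral_add (integrable_finsetSum _ fun i _ => hi1 m i) (hi3 m),
      integral_finsetSum _ fun i _ => hi1 m i]
  have e2 : ∫ x in A, (∑ i, pd i g x * q i x + g x * r x) =
      ∑ i, (∫ x in A, pd i g x * q i x) + ∫ x in A, g x * r x := by
    rw [integral_add (integrable_finsetSum _ fun i _ => hi2 i) hi4,
      integral_finsetSum _ fun i _ => hi2 i]
  simp_rw [e1]
  rw [e2]
  refine (tendsto_finsetSum _ fun i _ => ?_).add ?_
  · exact tendsto_setIntegral_mul hAU hA (fun m => hcont (hΦ m i).continuous) (hq i) (hlim i)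
      (hpc i) (hC' i)
  · exact tendsto_setIntegral_mul hAU hA (fun m => hcont (hdc m)) hr hlimr hg.continuous hC

theorem exists_bound_pd {K : Set Plane} (hK : IsCompact K) {g : Plane → ℝ} (hg : ContDiff ℝ ∞ g) :
    ∃ C, (∀ x ∈ K, |g x| ≤ C) ∧ ∀ i, ∀ x ∈ K, |pd i g x| ≤ C := by
  obtain ⟨C, hC⟩ := hK.exists_bound_of_continuousOn hg.continuous.continuousOn
  have h : ∀ i, ∃ C, ∀ x ∈ K, ‖pd i g x‖ ≤ C := fun i =>
    hK.exists_bound_of_continuousOn (contDiff_pd hg i).continuous.continuousOn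
  choose B hB using h
  refine ⟨max C (max (B 0) (B 1)), fun x hx => (hC x hx).trans (le_max_left _ _), fun i x hx => ?_⟩
  refine (hB i x hx).trans (le_trans ?_ (le_max_right _ _))
  fin_cases i
  · exact le_max_left _ _
  · exact le_max_right _ _

/-- Green's formula on the mesh for a vector field on the domain with normal traces. -/
theorem HasNormalTrace.sum_setIntegral {Ω : Set Plane} {𝒯 : Triangulation Ω} (F : EdgeFrame 𝒯)
    {j : Finset Plane → Plane → ℝ} {q : Fin 2 → Plane → ℝ} {r : Plane → ℝ}
    {ψ : Finset Plane → Plane → ℝ} (h : HasNormalTrace Ω 𝒯.edges F.n j q r ψ)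
    (hj : ∀ e, Continuous (j e)) {P : Finset Plane → Plane → ℝ} (hP : ∀ T, ContDiff ℝ ∞ (P T))
    (hPj : ∀ e ∈ 𝒯.edges, ∃ C, ∀ x ∈ hull e, |F.jump P e x| ≤ C * |j e x|)
    (hPψ : ∀ e ∈ 𝒯.edges,
      IntegrableOn (fun x => F.jump P e x * ψ e x) (hull e) (Measure.hausdorffMeasure 1)) :
    ∑ T ∈ 𝒯.triangles, ∫ x in hull T, (∑ i, pd i (P T) x * q i x + P T x * r x) =
      ∑ e ∈ 𝒯.edges, edgeIntegral e fun x => F.jump P e x * ψ e x := by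
  obtain ⟨hq, hr, hψ, Φ, hΦ, hlim, hlimr, hlime⟩ := h
  have hL : Tendsto (fun m => ∑ T ∈ 𝒯.triangles, ∫ x in hull T,
      (∑ i, pd i (P T) x * Φ m i x + P T x * ∑ i, pd i (Φ m i) x)) atTop
      (𝓝 (∑ T ∈ 𝒯.triangles, ∫ x in hull T, (∑ i, pd i (P T) x * q i x + P T x * r x))) := by
    refine tendsto_finsetSum _ fun T hT => ?_
    obtain ⟨C, hC, hC'⟩ := exists_bound_pd (isCompact_hull T) (hP T)
    exact tendsto_setIntegral_green (𝒯.hull_ae_le_domain hT) (isCompact_hull T).measurableSet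
      𝒯.isCompact_space 𝒯.domain_subset_space hq hr hΦ hlim hlimr (hP T) hC hC'
  simp_rw [F.sum_setIntegral_div hP (hΦ _)] at hL
  -- The volume side converges to its claimed value; the edge side is now shown to converge to its
  -- own, so the two limits agree.
  refine tendsto_nhds_unique hL (tendsto_finsetSum _ fun e he => ?_)
  obtain ⟨C, hC⟩ := hPj e he
  have hΦn : ∀ m, Continuous fun x => ∑ i, Φ m i x * F.n e i := fun m =>
    continuous_finsetSum _ fun i _ => (hΦ m i).continuous.mul continuous_const
  have hcard := (𝒯.mem_edges.1 he).2
  refine tendsto_integral_of_abs_sub_le (C := C)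
    (d := fun m x => |j e x| * |(∑ i, Φ m i x * F.n e i) - ψ e x|) (fun m => ?_) (hPψ e he)
    (fun m => ?_) (fun m => ?_) (hlime e he)
  · exact integrableOn_hull_of_continuous hcard
      ((F.continuous_jump (fun T => (hP T).continuous) e).mul (hΦn m))
  · have h1 := ((integrableOn_hull_of_continuous hcard ((hj e).mul (hΦn m))).sub (hψ e he)).abs
    refine h1.congr (Eventually.of_forall fun x => ?_)
    simp only [Pi.sub_apply, Pi.mul_apply, ← abs_mul, mul_sub]
  · refine (ae_restrict_iff' (isCompact_hull e).measurableSet).2 (Eventually.of_forall fun x hx => ?_)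
    rw [← mul_sub, abs_mul, ← mul_assoc]
    exact mul_le_mul_of_nonneg_right (hC x hx) (abs_nonneg _)

/-! ### Test functions -/

theorem hasCompactSupport_pd {φ : Plane → ℝ} (hφ : HasCompactSupport φ) (i : Fin 2) :
    HasCompactSupport (pd i φ) :=
  hφ.fderiv_apply ℝ _

theorem tsupport_pd_subset (φ : Plane → ℝ) (i : Fin 2) : tsupport (pd i φ) ⊆ tsupport φ :=
  tsupport_fderiv_apply_subset ℝ _

theorem exists_H20_of_test {Ω : Set Plane} {φ : Plane → ℝ} (hφ : ContDiff ℝ ∞ φ)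
    (hc : HasCompactSupport φ) (hs : tsupport φ ⊆ Ω) :
    ∃ v : H20 Ω, fnOf v =ᵐ[volume.restrict Ω] φ ∧
      ∀ i j, D2 v i j =ᵐ[volume.restrict Ω] pd i (pd j φ) := by
  have h0 : MemLp φ 2 (volume.restrict Ω) := hφ.continuous.memLp_of_hasCompactSupport hc
  have h1 : ∀ i, MemLp (pd i φ) 2 (volume.restrict Ω) := fun i =>
    (contDiff_pd hφ i).continuous.memLp_of_hasCompactSupport (hasCompactSupport_pd hc i)
  have h2 : ∀ i j, MemLp (pd i (pd j φ)) 2 (volume.restrict Ω) := fun i j =>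
    (contDiff_pd (contDiff_pd hφ j) i).continuous.memLp_of_hasCompactSupport
      (hasCompactSupport_pd (hasCompactSupport_pd hc j) i)
  let x : Jet Ω := (h0.toLp, fun i => (h1 i).toLp, fun i j => (h2 i j).toLp)
  have hx : IsTestJet Ω x := ⟨φ, hφ, hc, hs, h0.coeFn_toLp, fun i => (h1 i).coeFn_toLp,
    fun i j => (h2 i j).coeFn_toLp⟩
  exact ⟨⟨x, Submodule.le_topologicalClosure _ (Submodule.subset_span hx)⟩, h0.coeFn_toLp,
    fun i j => (h2 i j).coeFn_toLp⟩

/-- The integrand is a derivative of the compactly supported product g Φ. -/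
theorem integral_pd_mul_add_eq_zero {g Φ : Plane → ℝ} (hg : ContDiff ℝ ∞ g)
    (hc : HasCompactSupport g) (hΦ : ContDiff ℝ ∞ Φ) (i : Fin 2) :
    Integrable (fun x => pd i g x * Φ x + g x * pd i Φ x) ∧
      ∫ x, (pd i g x * Φ x + g x * pd i Φ x) = 0 := by
  have hi1 : Integrable fun x => pd i g x * Φ x :=
    ((contDiff_pd hg i).continuous.mul hΦ.continuous).integrable_of_hasCompactSupport
      ((hasCompactSupport_pd hc i).mul_right)
  have hi2 : Integrable fun x => g x * pd i Φ x :=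
    (hg.continuous.mul (contDiff_pd hΦ i).continuous).integrable_of_hasCompactSupport
      hc.mul_right
  have hi3 : Integrable fun x => g x * Φ x :=
    (hg.continuous.mul hΦ.continuous).integrable_of_hasCompactSupport hc.mul_right
  refine ⟨hi1.add hi2, ?_⟩
  have h := integral_mul_fderiv_eq_neg_fderiv_mul_of_integrable hi1 hi2 hi3
    (fun x _ => hg.differentiable (by simp) x) (fun x _ => hΦ.differentiable (by simp) x)
  rw [integral_add hi1 hi2]
  simp only [pd]
  rw [h]
  ring

/-- The limit `r` of the divergences is the weak divergence of `q`. -/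
theorem HasNormalTrace.setIntegral_test_eq_zero {Ω : Set Plane} (𝒯 : Triangulation Ω)
    {s : Finset (Finset Plane)} {n : Finset Plane → Plane} {j : Finset Plane → Plane → ℝ}
    {q : Fin 2 → Plane → ℝ} {r : Plane → ℝ} {ψ : Finset Plane → Plane → ℝ}
    (h : HasNormalTrace Ω s n j q r ψ) {g : Plane → ℝ} (hg : ContDiff ℝ ∞ g)
    (hc : HasCompactSupport g) (hs : tsupport g ⊆ Ω) :
    ∫ x in Ω, (∑ i, pd i g x * q i x + g x * r x) = 0 := by
  obtain ⟨hq, hr, -, Φ, hΦ, hlim, hlimr, -⟩ := h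
  obtain ⟨C, hC, hC'⟩ := exists_bound_pd 𝒯.isCompact_space hg
  have hL := tendsto_setIntegral_green (A := Ω) (EventuallyLE.refl _ _)
    𝒯.isOpen_domain.measurableSet 𝒯.isCompact_space 𝒯.domain_subset_space hq hr hΦ hlim hlimr hg
    (fun x hx => hC x (𝒯.domain_subset_space hx))
    (fun i x hx => hC' i x (𝒯.domain_subset_space hx))
  refine tendsto_nhds_unique hL (tendsto_const_nhds.congr fun m => ?_)
  -- The test function vanishes off Ω, so the integral extends to the whole plane, where no boundary
  -- terms arise.
  have hz : ∀ x ∉ Ω, ∑ i, pd i g x * Φ m i x + g x * ∑ i, pd i (Φ m i) x = 0 := by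
    intro x hx
    have h1 : g x = 0 := image_eq_zero_of_notMem_tsupport fun h => hx (hs h)
    have h2 : ∀ i, pd i g x = 0 := fun i =>
      image_eq_zero_of_notMem_tsupport fun h => hx (hs (tsupport_pd_subset g i h))
    simp [h1, h2]
  rw [setIntegral_eq_integral_of_forall_compl_eq_zero hz]
  simp only [Finset.mul_sum, ← Finset.sum_add_distrib]
  rw [integral_finsetSum _ fun i _ => (integral_pd_mul_add_eq_zero hg hc (hΦ m i) i).1]
  exact (Finset.sum_eq_zero fun i _ => (integral_pd_mul_add_eq_zero hg hc (hΦ m i) i).2).symm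

/-- The strong form `div div D²ũ = f̃` of the dual problem. -/
theorem IsDualSolution.ae_eq {Ω : Set Plane} (𝒯 : Triangulation Ω) {ft : L2 Ω} {ut : H20 Ω}
    (hut : IsDualSolution ft ut) {s : Finset (Finset Plane)} {n : Finset Plane → Plane}
    {j j' : Finset Plane → Plane → ℝ} {q : Fin 2 → Plane → ℝ} {r : Plane → ℝ}
    {t : Finset Plane → Fin 2 → Plane → ℝ} {d : Finset Plane → Plane → ℝ}
    (hM : ∀ i, HasNormalTrace Ω s n j ((D2 ut).fn i) (q i) (fun e => t e i))
    (hq : HasNormalTrace Ω s n j' q r d) : ft =ᵐ[volume.restrict Ω] r := by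
  have hΩ := 𝒯.isOpen_domain
  have := 𝒯.isFiniteMeasure_restrict_domain
  have hft : IntegrableOn ft Ω := (Lp.memLp ft).integrable (by norm_num)
  have key : ∀ φ : Plane → ℝ, ContDiff ℝ ∞ φ → HasCompactSupport φ → tsupport φ ⊆ Ω →
      ∫ x, φ x • (r x - ft x) = 0 := by
    intro φ hφ hc hs
    have hbd : ∀ {g f : Plane → ℝ}, ContDiff ℝ ∞ g → IntegrableOn f Ω →
        IntegrableOn (fun x => g x * f x) Ω := by
      intro g f hg hf
      obtain ⟨C, hC, -⟩ := exists_bound_pd 𝒯.isCompact_space hg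
      exact integrableOn_mul_of_bounded (EventuallyLE.refl _ _) hΩ.measurableSet hg.continuous
        (fun x hx => hC x (𝒯.domain_subset_space hx)) hf
    obtain ⟨v, hv, hv2⟩ := exists_H20_of_test hφ hc hs
    have hpd := fun i => contDiff_pd hφ i
    -- The i-th row of D²ũ is tested with ∂ᵢφ and its divergence field q with φ itself; adding the
    -- two gives ∫ D²ũ : D²φ = ∫ φ r, while the dual problem gives ∫ φ f̃ for the same quantity.
    have h1 : ∀ i, ∑ k, (∫ x in Ω, pd k (pd i φ) x * D2 ut i k x) +
        ∫ x in Ω, pd i φ x * q i x = 0 := by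
      intro i
      have := (hM i).setIntegral_test_eq_zero 𝒯 (hpd i) (hasCompactSupport_pd hc i)
        ((tsupport_pd_subset φ i).trans hs)
      rwa [integral_add, integral_finsetSum] at this
      · exact fun k _ => hbd (contDiff_pd (hpd i) k) ((hM i).1 k)
      · exact integrable_finsetSum _ fun k _ => hbd (contDiff_pd (hpd i) k) ((hM i).1 k)
      · exact hbd (hpd i) (hM i).2.1
    have h2 : ∑ i, (∫ x in Ω, pd i φ x * q i x) + ∫ x in Ω, φ x * r x = 0 := by
      have := hq.setIntegral_test_eq_zero 𝒯 hφ hc hs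
      rwa [integral_add, integral_finsetSum] at this
      · exact fun k _ => hbd (hpd k) (hq.1 k)
      · exact integrable_finsetSum _ fun k _ => hbd (hpd k) (hq.1 k)
      · exact hbd hφ hq.2.1
    have h3 : tensorIntegral Ω (D2 ut).fn (D2 v).fn =
        ∑ i, ∑ k, ∫ x in Ω, pd k (pd i φ) x * D2 ut i k x := by
      have : tensorIntegral Ω (D2 ut).fn (D2 v).fn =
          ∫ x in Ω, ∑ i, ∑ k, pd k (pd i φ) x * D2 ut i k x := by
        refine integral_congr_ae ?_
        have hall : ∀ᵐ x ∂volume.restrict Ω, ∀ i k, D2 v i k x = pd i (pd k φ) x :=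
          ae_all_iff.2 fun i => ae_all_iff.2 fun k => hv2 i k
        filter_upwards [hall] with x hx
        refine Finset.sum_congr rfl fun i _ => Finset.sum_congr rfl fun k _ => ?_
        simp only [Tensor.fn]
        rw [hx, pd_comm hφ, mul_comm]
      rw [this, integral_finsetSum]
      · refine Finset.sum_congr rfl fun i _ => integral_finsetSum _ fun k _ => ?_
        exact hbd (contDiff_pd (hpd i) k) ((hM i).1 k)
      · exact fun i _ => integrable_finsetSum _ fun k _ =>
          hbd (contDiff_pd (hpd i) k) ((hM i).1 k)
    have h4 : goal ft (fnOf v) = ∫ x in Ω, φ x * ft x := by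
      refine integral_congr_ae ?_
      filter_upwards [hv] with x hx
      rw [hx, mul_comm]
    have h5 := hut v
    have h6 : ∫ x, φ x • (r x - ft x) = ∫ x in Ω, φ x * (r x - ft x) := by
      refine (setIntegral_eq_integral_of_forall_compl_eq_zero fun x hx => ?_).symm
      change φ x * (r x - ft x) = 0
      rw [image_eq_zero_of_notMem_tsupport fun h => hx (hs h), zero_mul]
    rw [h6]
    simp only [mul_sub]
    rw [integral_sub (hbd hφ hq.2.1) (hbd hφ hft)]
    rw [h3, h4] at h5
    have h7 := Finset.sum_eq_zero fun i (_ : i ∈ Finset.univ) => h1 i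
    rw [Finset.sum_add_distrib] at h7
    linarith
  -- The fundamental lemma of the calculus of variations on the open set Ω.
  have h := hΩ.ae_eq_zero_of_integral_contDiff_smul_eq_zero (μ := volume)
    (f := fun x => r x - ft x) (hq.2.1.sub hft).locallyIntegrableOn key
  refine (ae_restrict_iff' hΩ.measurableSet).2 ?_
  filter_upwards [h] with x hx hxΩ
  linarith [hx hxΩ]

/-! ### The representation of the discrete goal -/

section tensorIntegral

variable {A : Set Plane} {p p' q q' : Fin 2 → Fin 2 → Plane → ℝ}

theorem integrable_tensor (hp : ∀ i j, MemLp (p i j) 2 (volume.restrict A))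
    (hq : ∀ i j, MemLp (q i j) 2 (volume.restrict A)) :
    IntegrableOn (fun x => ∑ i, ∑ j, p i j x * q i j x) A :=
  integrable_finsetSum _ fun i _ => integrable_finsetSum _ fun j _ =>
    (hp i j).integrable_mul (hq i j)

theorem tensorIntegral_sub_left (hp : ∀ i j, MemLp (p i j) 2 (volume.restrict A))
    (hp' : ∀ i j, MemLp (p' i j) 2 (volume.restrict A))
    (hq : ∀ i j, MemLp (q i j) 2 (volume.restrict A)) :
    tensorIntegral A (p - p') q = tensorIntegral A p q - tensorIntegral A p' q := by
  rw [tensorIntegral, tensorIntegral, tensorIntegral,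
    ← integral_sub (integrable_tensor hp hq) (integrable_tensor hp' hq)]
  refine integral_congr_ae (Eventually.of_forall fun x => ?_)
  simp only [Pi.sub_apply, sub_mul, Finset.sum_sub_distrib]

theorem tensorIntegral_sub_right (hp : ∀ i j, MemLp (p i j) 2 (volume.restrict A))
    (hq : ∀ i j, MemLp (q i j) 2 (volume.restrict A))
    (hq' : ∀ i j, MemLp (q' i j) 2 (volume.restrict A)) :
    tensorIntegral A p (q - q') = tensorIntegral A p q - tensorIntegral A p q' := by
  rw [tensorIntegral, tensorIntegral, tensorIntegral,
    ← integral_sub (integrable_tensor hp hq) (integrable_tensor hp hq')]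
  refine integral_congr_ae (Eventually.of_forall fun x => ?_)
  simp only [Pi.sub_apply, mul_sub, Finset.sum_sub_distrib]

theorem tensorIntegral_comm (A : Set Plane) (p q : Fin 2 → Fin 2 → Plane → ℝ) :
    tensorIntegral A p q = tensorIntegral A q p := by
  simp only [tensorIntegral, mul_comm]

end tensorIntegral

section frame

variable {Ω : Set Plane} {𝒯 : Triangulation Ω} (F : EdgeFrame 𝒯)

/-- Parseval's identity in the orthonormal basis (τ_e, n_e). -/
theorem EdgeFrame.sum_mul_eq {e : Finset Plane} (he : e ∈ 𝒯.edges) (a b : Fin 2 → ℝ) :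
    ∑ i, a i * b i = (∑ i, a i * F.τ e i) * (∑ i, F.τ e i * b i) +
      (∑ i, a i * F.n e i) * ∑ i, F.n e i * b i := by
  have h1 : F.n e 0 ^ 2 + F.n e 1 ^ 2 = 1 := by
    have := EuclideanSpace.real_norm_sq_eq (F.n e)
    rw [F.norm_n e he, Fin.sum_univ_two] at this
    linarith
  have h2 : F.τ e 0 ^ 2 + F.τ e 1 ^ 2 = 1 := by
    have := EuclideanSpace.real_norm_sq_eq (F.τ e)
    rw [F.norm_τ e he, Fin.sum_univ_two] at this
    linarith
  have h3 : F.n e 0 * F.τ e 0 + F.n e 1 * F.τ e 1 = 0 := by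
    rw [← F.τ_perp e he]; simp [PiLp.inner_apply, Fin.sum_univ_two]; ring
  simp only [Fin.sum_univ_two]
  set n0 := F.n e 0
  set n1 := F.n e 1
  set t0 := F.τ e 0
  set t1 := F.τ e 1
  -- The orientation of τ_e is not prescribed, so τ_e is l times the rotated normal with l = ±1;
  -- only l² enters.
  have hl : (n0 * t1 - n1 * t0) ^ 2 = 1 := by
    linear_combination h1 * (t0 ^ 2 + t1 ^ 2) + h2 - (n0 * t0 + n1 * t1) * h3
  set l := n0 * t1 - n1 * t0 with hl'
  have e0 : t0 = -(l * n1) := by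
    rw [hl']; linear_combination (-t0) * h1 + n0 * h3
  have e1 : t1 = l * n0 := by
    rw [hl']; linear_combination (-t1) * h1 + n1 * h3
  rw [e0, e1]
  linear_combination (-(a 0 * b 0 + a 1 * b 1)) * h1 -
    ((a 0 * n1 - a 1 * n0) * (n1 * b 0 - n0 * b 1)) * hl

variable {k : ℕ} (v : BrokenPoly 𝒯 k)

theorem BrokenPoly.contDiff_val (T : Finset Plane) : ContDiff ℝ ∞ (v.val T) := contDiff_eval _

theorem BrokenPoly.contDiff_grad (i : Fin 2) (T : Finset Plane) : ContDiff ℝ ∞ (v.grad i T) :=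
  contDiff_eval _

theorem BrokenPoly.pd_val (i : Fin 2) (T : Finset Plane) (x : Plane) :
    pd i (v.val T) x = v.grad i T x := pd_eval _ _ _

theorem BrokenPoly.pd_grad (i j : Fin 2) (T : Finset Plane) (x : Plane) :
    pd j (v.grad i T) x = v.hess T i j x := by
  rw [BrokenPoly.hess, pderiv_pderiv_comm]
  exact pd_eval _ _ _

theorem BrokenPoly.sum_jump_grad_mul (e : Finset Plane) (a : Plane) (x : Plane) :
    ∑ i, F.jump (v.grad i) e x * a i = F.jump (fun T y => ∑ i, v.grad i T y * a i) e x := by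
  simp only [EdgeFrame.jump, Fin.sum_univ_two, Finset.sum_add_distrib, ← Finset.sum_mul]
  ring

end frame

/-- The representation of the goal of a piecewise polynomial by the dual solution. -/
theorem goal_brokenPoly {Ω : Set Plane} {𝒯 : Triangulation Ω} (F : EdgeFrame 𝒯) {k : ℕ}
    {ft : L2 Ω} {ut : H20 Ω} (hut : IsDualSolution ft ut) (v : BrokenPoly 𝒯 k) (D : EdgeTraces)
    (hD : HasMomentTrace Ω 𝒯.edges F.n (v.jump F) (D2 ut).fn D.vec D.div) :
    goal ft v.toL2 = ∑ T ∈ 𝒯.triangles, tensorIntegral (hull T) (v.hess T) (D2 ut).fn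
      - ∑ e ∈ 𝒯.edges, edgeIntegral e (fun x => v.jumpT F e x * D.nτ F e x)
      - ∑ e ∈ 𝒯.edges, edgeIntegral e (fun x => v.jumpN F e x * D.nn F e x)
      + ∑ e ∈ 𝒯.edges, edgeIntegral e (fun x => v.jump F e x * D.div e x) := by
  obtain ⟨q, r, hM, hq⟩ := hD
  have hrft := hut.ae_eq 𝒯 hM hq
  have hle : ∀ T ∈ 𝒯.triangles, volume.restrict (hull T) ≤ volume.restrict Ω := fun T hT =>
    Measure.restrict_mono_ae (𝒯.hull_ae_le_domain hT)
  have hbd : ∀ T ∈ 𝒯.triangles, ∀ {g f : Plane → ℝ}, ContDiff ℝ ∞ g → IntegrableOn f Ω →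
      IntegrableOn (fun x => g x * f x) (hull T) := by
    intro T hT g f hg hf
    obtain ⟨C, hC, -⟩ := exists_bound_pd (isCompact_hull T) hg
    exact integrableOn_mul_of_bounded (𝒯.hull_ae_le_domain hT) (isCompact_hull T).measurableSet
      hg.continuous hC hf
  have hbe : ∀ e ∈ 𝒯.edges, ∀ {g f : Plane → ℝ}, Continuous g →
      IntegrableOn f (hull e) (Measure.hausdorffMeasure 1) →
      IntegrableOn (fun x => g x * f x) (hull e) (Measure.hausdorffMeasure 1) := by
    intro e he g f hg hf
    obtain ⟨C, hC⟩ := (isCompact_hull e).exists_bound_of_continuousOn hg.continuousOn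
    exact Integrable.bdd_mul hf hg.aestronglyMeasurable
      ((ae_restrict_iff' (isCompact_hull e).measurableSet).2 (Eventually.of_forall hC))
  have hvec : ∀ e ∈ 𝒯.edges, ∀ i,
      IntegrableOn (D.vec e i) (hull e) (Measure.hausdorffMeasure 1) := fun e he i => by
    simpa using (hM i).2.2.1 e he
  have hjg : ∀ i e, Continuous (F.jump (v.grad i) e) := fun i e =>
    F.continuous_jump (fun T => (v.contDiff_grad i T).continuous) e
  -- Green's formula for ∂ᵢv and the i-th row of D²ũ, with weight 1: a continuous jump is bounded on
  -- the compact edge.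
  have hrow : ∀ i, ∑ T ∈ 𝒯.triangles, (∑ j, (∫ x in hull T, v.hess T i j x * D2 ut i j x) +
      ∫ x in hull T, v.grad i T x * q i x) =
      ∑ e ∈ 𝒯.edges, edgeIntegral e fun x => F.jump (v.grad i) e x * D.vec e i x := by
    intro i
    rw [← (hM i).sum_setIntegral F (fun _ => continuous_const) (v.contDiff_grad i) (fun e _ => ?_)
      (fun e he => hbe e he (hjg i e) (hvec e he i))]
    · refine Finset.sum_congr rfl fun T hT => ?_
      have hi : ∀ j, IntegrableOn (fun x => v.hess T i j x * D2 ut i j x) (hull T) := fun j =>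
        hbd T hT (contDiff_eval _) ((hM i).1 j)
      rw [← integral_finsetSum _ fun j _ => hi j,
        ← integral_add (integrable_finsetSum _ fun j _ => hi j)
          (hbd T hT (v.contDiff_grad i T) (hM i).2.1)]
      simp only [v.pd_grad]
      rfl
    · obtain ⟨C, hC⟩ := (isCompact_hull e).exists_bound_of_continuousOn (hjg i e).continuousOn
      exact ⟨C, fun x hx => by simpa using hC x hx⟩
  -- Green's formula for v and div D²ũ. The weight is the jump of v itself, so domination holds with
  -- constant 1.
  have hlast : ∑ T ∈ 𝒯.triangles, (∑ i, (∫ x in hull T, v.grad i T x * q i x) +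
      ∫ x in hull T, v.val T x * r x) =
      ∑ e ∈ 𝒯.edges, edgeIntegral e fun x => v.jump F e x * D.div e x := by
    have hjc : ∀ e, Continuous (v.jump F e) :=
      F.continuous_jump fun T => (v.contDiff_val T).continuous
    refine Eq.trans ?_ (hq.sum_setIntegral F hjc v.contDiff_val
      (fun e _ => ⟨1, fun x _ => by rw [one_mul]; rfl⟩) hq.2.2.1)
    refine Finset.sum_congr rfl fun T hT => ?_
    have hi : ∀ j, IntegrableOn (fun x => v.grad j T x * q j x) (hull T) := fun j =>
      hbd T hT (v.contDiff_grad j T) (hq.1 j)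
    rw [← integral_finsetSum _ fun j _ => hi j,
      ← integral_add (integrable_finsetSum _ fun j _ => hi j)
        (hbd T hT (v.contDiff_val T) hq.2.1)]
    simp only [v.pd_val]
  have hgoal : goal ft v.toL2 = ∑ T ∈ 𝒯.triangles, ∫ x in hull T, v.val T x * r x := by
    have hi : IntegrableOn (fun x => ft x * v.toL2 x) Ω :=
      (Lp.memLp ft).integrable_mul (Lp.memLp v.toL2)
    rw [goal, 𝒯.setIntegral_domain hi]
    refine Finset.sum_congr rfl fun T hT => integral_congr_ae ?_
    filter_upwards [v.ae_eq T hT, ae_mono (hle T hT) hrft] with x h1 h2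
    rw [h1, h2, mul_comm]
    rfl
  have hten : ∀ T ∈ 𝒯.triangles, tensorIntegral (hull T) (v.hess T) (D2 ut).fn =
      ∑ i, ∑ j, ∫ x in hull T, v.hess T i j x * D2 ut i j x := by
    intro T hT
    have hi : ∀ i j, IntegrableOn (fun x => v.hess T i j x * D2 ut i j x) (hull T) := fun i j =>
      hbd T hT (contDiff_eval _) ((hM i).1 j)
    rw [tensorIntegral]
    simp only [Tensor.fn]
    rw [integral_finsetSum _ fun i _ => integrable_finsetSum _ fun j _ => hi i j]
    exact Finset.sum_congr rfl fun i _ => integral_finsetSum _ fun j _ => hi i j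
  have hedge : ∀ e ∈ 𝒯.edges, edgeIntegral e (fun x => v.jumpT F e x * D.nτ F e x) +
      edgeIntegral e (fun x => v.jumpN F e x * D.nn F e x) =
      ∑ i, edgeIntegral e fun x => F.jump (v.grad i) e x * D.vec e i x := by
    intro e he
    have hdir : ∀ a : Plane, Continuous (F.jump (fun T y => ∑ i, v.grad i T y * a i) e) := fun a =>
      F.continuous_jump (fun T => continuous_finsetSum _ fun i _ =>
        (v.contDiff_grad i T).continuous.mul continuous_const) e
    have hcomb : ∀ a : Plane, IntegrableOn (fun x => ∑ i, a i * D.vec e i x) (hull e)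
        (Measure.hausdorffMeasure 1) := fun a =>
      integrable_finsetSum _ fun i _ => (hvec e he i).const_mul _
    have hiT : IntegrableOn (fun x => v.jumpT F e x * D.nτ F e x) (hull e)
        (Measure.hausdorffMeasure 1) := hbe e he (hdir _) (hcomb _)
    have hiN : IntegrableOn (fun x => v.jumpN F e x * D.nn F e x) (hull e)
        (Measure.hausdorffMeasure 1) := hbe e he (hdir _) (hcomb _)
    simp only [edgeIntegral]
    rw [← integral_add hiT hiN,
      ← integral_finsetSum _ fun i _ => hbe e he (hjg i e) (hvec e he i)]
    refine integral_congr_ae (Eventually.of_forall fun x => ?_)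
    simp only
    rw [F.sum_mul_eq he, v.sum_jump_grad_mul, v.sum_jump_grad_mul]
    rfl
  -- Summing the row formulas over i produces the volume term ∇v · div D²ũ, which also occurs in
  -- `hlast`; eliminating it leaves the claim.
  have hE := Finset.sum_congr rfl hedge
  rw [Finset.sum_add_distrib, Finset.sum_comm, ← Finset.sum_congr rfl fun i _ => hrow i,
    Finset.sum_comm] at hE
  simp only [Finset.sum_add_distrib] at hE hlast
  rw [Finset.sum_congr rfl hten, hgoal]
  linarith

/-! ### Integrability of the glued edge values. -/

section edgeValue

variable {Ω : Set Plane} {𝒯 : Triangulation Ω} (F : EdgeFrame 𝒯)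

theorem Triangulation.mem_edgesOf {e T : Finset Plane} :
    e ∈ 𝒯.edgesOf T ↔ e ∈ 𝒯.edges ∧ e ⊆ T := by
  simp [Triangulation.edgesOf]

/-- The edge value is a finite linear combination of the one-sided traces, so integrability against
`g` is inherited from them for every `w`. -/
theorem EdgeFrame.integrableOn_mul_edgeValue {e : Finset Plane} (he : e ∈ 𝒯.edges) (w : ℝ)
    {g : Plane → ℝ} {φ : Finset Plane → Plane → ℝ}
    (h : ∀ T ∈ 𝒯.triangles, e ∈ 𝒯.edgesOf T →
      IntegrableOn (fun x => g x * φ T x) (hull e) (Measure.hausdorffMeasure 1)) :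
    IntegrableOn (fun x => g x * F.edgeValue w φ e x) (hull e) (Measure.hausdorffMeasure 1) := by
  have hp := h _ (F.plus_mem e he) (Triangulation.mem_edgesOf.2 ⟨he, F.subset_plus e he⟩)
  have hm : ∀ T ∈ F.minus e,
      IntegrableOn (fun x => g x * φ T x) (hull e) (Measure.hausdorffMeasure 1) := fun T hT =>
    h T (F.mem_minus.1 hT).1 (Triangulation.mem_edgesOf.2 ⟨he, (F.mem_minus.1 hT).2.1⟩)
  refine (hp.sub ((integrable_finsetSum _ fun T hT => hp.sub (hm T hT)).const_mul w)).congr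
    (Eventually.of_forall fun x => ?_)
  simp only [Pi.sub_apply, EdgeFrame.edgeValue, ← mul_sub, ← Finset.mul_sum]
  ring

end edgeValue

/-- Adds an edge term of the estimator to its counterpart in the remainder. Both products must be
integrable for the integral of the difference to split. -/
theorem edgeIntegral_mul_add_mul_sub {e : Finset Plane} {g a b : Plane → ℝ}
    (ha : IntegrableOn (fun x => g x * a x) (hull e) (Measure.hausdorffMeasure 1))
    (hb : IntegrableOn (fun x => g x * b x) (hull e) (Measure.hausdorffMeasure 1)) :
    edgeIntegral e (fun x => g x * b x) + edgeIntegral e (fun x => g x * (a x - b x)) =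
      edgeIntegral e fun x => g x * a x := by
  simp only [mul_sub, edgeIntegral]
  rw [integral_sub ha hb]
  ring

end GoalBiharmonic

end

/-! ### The error identity. -/

open GoalBiharmonic
theorem theorem4p1 {Ω : Set Plane} (𝒯 : Triangulation Ω) (F : EdgeFrame 𝒯) (k : ℕ)
    -- the data, the primal and the dual solution
    (f : HMinus2 Ω) (ft : L2 Ω) (u ut : H20 Ω)
    (hu : IsPrimalSolution f u) (hut : IsDualSolution ft ut)
    -- arbitrary piecewise polynomials
    (uh uth : BrokenPoly 𝒯 k)
    -- potential reconstructions
    (s st : H20 Ω) (hs : IsPotentialReconstruction s) (hst : IsPotentialReconstruction st)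
    -- equilibrated moment tensors
    (fh fth : HMinus2 Ω) (σ σt : Tensor Ω)
    (hσ : IsEquilibrated fh σ) (hσt : IsEquilibrated fth σt)
    -- the traces of `D²ũ` and `div D²ũ` on the edges
    (D : EdgeTraces)
    (hD : HasMomentTrace Ω 𝒯.edges F.n (uh.jump F) (D2 ut).fn D.vec D.div)
    -- the traces of `σ̃_h^eq` and `div σ̃_h^eq` on the edges, from inside each triangle
    (t : Finset Plane → EdgeTraces)
    (ht : ∀ T ∈ 𝒯.triangles, HasMomentTrace (interior (hull T)) (𝒯.edgesOf T) F.n (uh.jump F)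
      σt.fn (t T).vec (t T).div)
    (w : Finset Plane → ℝ) :
    goal ft (fnOf u) - goal ft uh.toL2 =
      estimator F f uh st σ σt (EdgeTraces.glue F w t) +
        remainder F f ut uh st σ σt (EdgeTraces.glue F w t) D := by
  -- Reciprocity of the two weak problems, by symmetry of the Hessian form.
  have hQu : goal ft (fnOf u) = f ut := by rw [← hut u, tensorIntegral_comm, hu ut]
  have hQuh := goal_brokenPoly F hut uh D hD
  have hmem : ∀ (ρ : Tensor Ω), ∀ T ∈ 𝒯.triangles, ∀ i j,
      MemLp (ρ.fn i j) 2 (volume.restrict (hull T)) := fun ρ T hT i j =>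
    (Lp.memLp (ρ i j)).mono_measure (Measure.restrict_mono_ae (𝒯.hull_ae_le_domain hT))
  have hhess : ∀ T, ∀ i j, MemLp (uh.hess T i j) 2 (volume.restrict (hull T)) := by
    intro T i j
    have hc : Continuous (uh.hess T i j) := (contDiff_eval _).continuous
    obtain ⟨C, hC⟩ := (isCompact_hull T).exists_bound_of_continuousOn hc.continuousOn
    have : IsFiniteMeasure (volume.restrict (hull T)) :=
      ⟨by rw [Measure.restrict_apply_univ]; exact (isCompact_hull T).measure_lt_top⟩
    exact MemLp.of_bound hc.aestronglyMeasurable C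
      ((ae_restrict_iff' (isCompact_hull T).measurableSet).2 (Eventually.of_forall hC))
  have hdom : ∀ v : H20 Ω, ∑ T ∈ 𝒯.triangles, tensorIntegral (hull T) σ.fn (D2 v).fn =
      divDiv σ v := by
    intro v
    rw [divDiv_apply]
    exact (𝒯.setIntegral_domain (integrable_tensor (fun i j => Lp.memLp (σ i j))
      fun i j => Lp.memLp (D2 v i j))).symm
  -- On each triangle σ̃_h^eq drops out of the sum, and the remaining pairing of σ_h^eq with D²ũ
  -- adds up to ⟨div div σ_h^eq, ũ⟩.
  have hvol : ∑ T ∈ 𝒯.triangles, tensorIntegral (hull T) (σ.fn - uh.hess T) σt.fn +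
      ∑ T ∈ 𝒯.triangles, tensorIntegral (hull T) (σ.fn - uh.hess T) ((D2 ut).fn - σt.fn) =
      divDiv σ ut - ∑ T ∈ 𝒯.triangles, tensorIntegral (hull T) (uh.hess T) (D2 ut).fn := by
    rw [← hdom, ← Finset.sum_add_distrib, ← Finset.sum_sub_distrib]
    refine Finset.sum_congr rfl fun T hT => ?_
    rw [tensorIntegral_sub_right (p := σ.fn - uh.hess T) (fun i j => (hmem σ T hT i j).sub (hhess T i j))
      (hmem _ T hT) (hmem _ T hT), tensorIntegral_sub_left (hmem σ T hT) (hhess T)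
      (hmem (D2 ut) T hT)]
    ring
  obtain ⟨q, r, hM, hq⟩ := hD
  have hbe : ∀ e ∈ 𝒯.edges, ∀ (a : Plane) {ρ : Fin 2 → Plane → ℝ} {g : Plane → ℝ}, Continuous g →
      (∀ i, IntegrableOn (ρ i) (hull e) (Measure.hausdorffMeasure 1)) →
      IntegrableOn (fun x => g x * ∑ i, a i * ρ i x) (hull e) (Measure.hausdorffMeasure 1) := by
    intro e he a ρ g hg hρ
    obtain ⟨C, hC⟩ := (isCompact_hull e).exists_bound_of_continuousOn hg.continuousOn
    exact Integrable.bdd_mul (integrable_finsetSum _ fun i _ => (hρ i).const_mul _)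
      hg.aestronglyMeasurable
      ((ae_restrict_iff' (isCompact_hull e).measurableSet).2 (Eventually.of_forall hC))
  have hDv : ∀ e ∈ 𝒯.edges, ∀ i,
      IntegrableOn (D.vec e i) (hull e) (Measure.hausdorffMeasure 1) := fun e he i => by
    simpa using (hM i).2.2.1 e he
  have hSv : ∀ e ∈ 𝒯.edges, ∀ i,
      IntegrableOn ((EdgeTraces.glue F w t).vec e i) (hull e) (Measure.hausdorffMeasure 1) := by
    intro e he i
    have h := F.integrableOn_mul_edgeValue he (w e) (g := fun _ => 1)
      (φ := fun T => (t T).vec e i) fun T hT heT => by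
        obtain ⟨_, _, h, -⟩ := ht T hT
        exact (h i).2.2.1 e heT
    simp only [one_mul] at h
    exact h
  have hSd : ∀ e ∈ 𝒯.edges, IntegrableOn
      (fun x => uh.jump F e x * (EdgeTraces.glue F w t).div e x) (hull e)
      (Measure.hausdorffMeasure 1) := by
    intro e he
    refine F.integrableOn_mul_edgeValue he (w e) (φ := fun T => (t T).div e) fun T hT heT => ?_
    obtain ⟨_, _, -, h⟩ := ht T hT
    exact h.2.2.1 e heT
  have hdir : ∀ e (a : Plane), Continuous (F.jump (fun T y => ∑ i, uh.grad i T y * a i) e) :=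
    fun e a => F.continuous_jump (fun T => continuous_finsetSum _ fun i _ =>
      (uh.contDiff_grad i T).continuous.mul continuous_const) e
  have hT : ∑ e ∈ 𝒯.edges, edgeIntegral e
        (fun x => uh.jumpT F e x * (EdgeTraces.glue F w t).nτ F e x) +
      ∑ e ∈ 𝒯.edges, edgeIntegral e
        (fun x => uh.jumpT F e x * (D.nτ F e x - (EdgeTraces.glue F w t).nτ F e x)) =
      ∑ e ∈ 𝒯.edges, edgeIntegral e (fun x => uh.jumpT F e x * D.nτ F e x) := by
    rw [← Finset.sum_add_distrib]
    exact Finset.sum_congr rfl fun e he => edgeIntegral_mul_add_mul_sub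
      (hbe e he _ (hdir e _) (hDv e he)) (hbe e he _ (hdir e _) (hSv e he))
  have hN : ∑ e ∈ 𝒯.edges, edgeIntegral e
        (fun x => uh.jumpN F e x * (EdgeTraces.glue F w t).nn F e x) +
      ∑ e ∈ 𝒯.edges, edgeIntegral e
        (fun x => uh.jumpN F e x * (D.nn F e x - (EdgeTraces.glue F w t).nn F e x)) =
      ∑ e ∈ 𝒯.edges, edgeIntegral e (fun x => uh.jumpN F e x * D.nn F e x) := by
    rw [← Finset.sum_add_distrib]
    exact Finset.sum_congr rfl fun e he => edgeIntegral_mul_add_mul_sub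
      (hbe e he _ (hdir e _) (hDv e he)) (hbe e he _ (hdir e _) (hSv e he))
  have hJ : ∑ e ∈ 𝒯.edges, edgeIntegral e
        (fun x => uh.jump F e x * (EdgeTraces.glue F w t).div e x) +
      ∑ e ∈ 𝒯.edges, edgeIntegral e
        (fun x => uh.jump F e x * (D.div e x - (EdgeTraces.glue F w t).div e x)) =
      ∑ e ∈ 𝒯.edges, edgeIntegral e (fun x => uh.jump F e x * D.div e x) := by
    rw [← Finset.sum_add_distrib]
    exact Finset.sum_congr rfl fun e he => edgeIntegral_mul_add_mul_sub
      (hq.2.2.1 e he) (hSd e he)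
  -- The terms in s̃_h and ⟨div div σ_h^eq, ũ⟩ cancel by linearity, leaving ⟨f, ũ⟩ minus the
  -- representation of Q(u_h).
  rw [estimator, remainder, hQu, hQuh, hdom, sub_apply, map_sub, map_sub]
  linarith
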